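/- Let $d,k$ be positive integers. Let $A(\xi)$, $\xi\in\mathbb R^d$, be a measurable function whose values are Hermitian $k\times k$-matrices, and let $P(D)=\Phi^*A\Phi$ be the corresponding self-adjoint operator in $L_2(\mathbb R^d;\mathbb C^k)$, where $(\Phi f)(\xi)=(2\pi)^{-d/2}\int_{\mathbb R^d}e^{-i\langle x,\xi\rangle}f(x)\,dx$ is the unitary Fourier transform, $A$ denotes multiplication by $A(\xi)$, and the domain $\mathcal D(P(D))$ consists of all $f\in L_2(\mathbb R^d;\mathbb C^k)$ such that $A\Phi f\in L_2(\mathbb R^d;\mathbb C^k)$. Suppose that $P(D)$ is strongly Carleman, that is, \[ \nu(\xi):=\min_{\mathbf n\in\mathbb C^k,\ |\mathbf n|=1}|A(\xi)\mathbf n|\to\infty\quad\text{as }|\xi|\to\infty . \] Let $M_0(x)$ and $M(x)$, $x\in\mathbb R^d$, be measurable functions whose values are Hermitian $k\times k$-matrices, such that $0<c_0\le M_0(x)\le c_1<\infty$ and $0<c_0\le M(x)\le c_1<\infty$ for all $x$ and some constants $c_0,c_1$. Let $\mathcal H$ be the space $L_2(\mathbb R^d;\mathbb C^k)$ with the scalar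 product $(f,g)_{\mathcal H}=\int_{\mathbb R^d}\langle M(x)f(x),g(x)\rangle_{\mathbb C^k}\,dx$, and let $\mathcal H_0$ be defined in the same way with $M_0$ in place of $M$. Consider the operators $H=M^{-1}P(D)$ in $\mathcal H$ and $H_0=M_0^{-1}P(D)$ in $\mathcal H_0$ on the common domain $\mathcal D(H)=\mathcal D(H_0)=\mathcal D(P(D))$. If \[ M(x)-M_0(x)\to0\quad\text{as }|x|\to\infty , \] then $\sigma^{ess}(H)=\sigma^{ess}(H_0)$, where the essential spectrum $\sigma^{ess}$ of an operator is its spectrum without isolated eigenvalues of finite multiplicity. -/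

import Mathlib

open MeasureTheory Filter Topology Bornology
open scoped FourierTransform ENNReal

noncomputable section

namespace MediumScattering

open scoped ComplexOrder

/-! ### Spectrum and essential spectrum of an unbounded operator -/

section Spectrum

variable {E : Type*} [NormedAddCommGroup E] [NormedSpace ℂ E]

/-- `z` is a regular point of the unbounded operator `T`: the operator `T - z`, defined on the
domain of `T`, has an everywhere defined bounded (two-sided) inverse `R`. -/
def IsRegularPoint (T : E →ₗ.[ℂ] E) (z : ℂ) : Prop :=
  ∃ R : E →L[ℂ] E,
    (∀ y : E, ∃ h : R y ∈ T.domain, T ⟨R y, h⟩ - z • R y = y) ∧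
    (∀ x : T.domain, R (T x - z • (x : E)) = x)

/-- The spectrum of an unbounded operator. -/
def opSpectrum (T : E →ₗ.[ℂ] E) : Set ℂ := {z | ¬ IsRegularPoint T z}

/-- The eigenspace `{f ∈ 𝓓(T) : T f = z f}`. -/
def eigenspace (T : E →ₗ.[ℂ] E) (z : ℂ) : Submodule ℂ E where
  carrier := {f | ∃ h : f ∈ T.domain, T ⟨f, h⟩ = z • f}
  zero_mem' := ⟨T.domain.zero_mem, by
    rw [smul_zero]; exact T.map_zero⟩
  add_mem' := by
    rintro f g ⟨hf, hf'⟩ ⟨hg, hg'⟩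
    refine ⟨T.domain.add_mem hf hg, ?_⟩
    rw [smul_add, ← hf', ← hg']
    exact T.map_add ⟨f, hf⟩ ⟨g, hg⟩
  smul_mem' := by
    rintro c f ⟨hf, hf'⟩
    refine ⟨T.domain.smul_mem c hf, ?_⟩
    rw [smul_comm, ← hf']
    exact T.map_smul c ⟨f, hf⟩

/-- `z` is an eigenvalue of finite multiplicity of `T` which is an isolated point of the
spectrum of `T`. -/
def IsIsolatedFiniteEigenvalue (T : E →ₗ.[ℂ] E) (z : ℂ) : Prop :=
  eigenspace T z ≠ ⊥ ∧ FiniteDimensional ℂ (eigenspace T z) ∧ ∀ᶠ w in 𝓝[≠] z, w ∉ opSpectrum T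

/-- The essential spectrum: the spectrum without isolated eigenvalues of finite multiplicity. -/
def essentialSpectrum (T : E →ₗ.[ℂ] E) : Set ℂ :=
  {z | z ∈ opSpectrum T ∧ ¬ IsIsolatedFiniteEigenvalue T z}

end Spectrum

/-! ### Multiplication by matrix-functions -/

/-- The space `ℝᵈ` with its Euclidean norm. -/
abbrev Sp (d : ℕ) := EuclideanSpace ℝ (Fin d)

/-- The space `L₂(ℝᵈ; ℂᵏ)`. -/
abbrev L2 (d k : ℕ) := Lp (α := Sp d) (EuclideanSpace ℂ (Fin k)) 2

/-- The action of a `k × k`-matrix on the Euclidean space `ℂᵏ`. -/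
abbrev act {k : ℕ} (B : Matrix (Fin k) (Fin k) ℂ) :
    EuclideanSpace ℂ (Fin k) →L[ℂ] EuclideanSpace ℂ (Fin k) :=
  Matrix.toEuclideanCLM (n := Fin k) (𝕜 := ℂ) B

/-- The maximal domain `{f ∈ L₂ : B f ∈ L₂}` of multiplication by a matrix-function `B`. -/
def mulDomain {d k : ℕ} (B : Sp d → Matrix (Fin k) (Fin k) ℂ) : Submodule ℂ (L2 d k) where
  carrier := {f | MemLp (fun x => act (B x) (f x)) 2 volume}
  zero_mem' := by
    refine (MemLp.zero (μ := volume) (p := 2) (ε := EuclideanSpace ℂ (Fin k))).ae_eq ?_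
    filter_upwards [Lp.coeFn_zero (EuclideanSpace ℂ (Fin k)) 2 (volume : Measure (Sp d))]
      with x hx
    rw [hx, Pi.zero_apply, map_zero]
  add_mem' := by
    intro f g hf hg
    refine (MemLp.add hf hg).ae_eq ?_
    filter_upwards [Lp.coeFn_add f g] with x hx
    rw [hx, Pi.add_apply, Pi.add_apply, map_add]
  smul_mem' := by
    intro c f hf
    refine (MemLp.const_smul hf c).ae_eq ?_
    filter_upwards [Lp.coeFn_smul c f] with x hx
    rw [hx, Pi.smul_apply, Pi.smul_apply, map_smul]

theorem mem_mulDomain {d k : ℕ} {B : Sp d → Matrix (Fin k) (Fin k) ℂ} {f : L2 d k} :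
    f ∈ mulDomain B ↔ MemLp (fun x => act (B x) (f x)) 2 volume := Iff.rfl

/-- The product `B f` as an element of `L₂`. -/
def mulFun {d k : ℕ} (B : Sp d → Matrix (Fin k) (Fin k) ℂ) (f : mulDomain B) : L2 d k :=
  MemLp.toLp (fun x => act (B x) ((f : L2 d k) x)) (mem_mulDomain.1 f.2)

theorem coeFn_mulFun {d k : ℕ} (B : Sp d → Matrix (Fin k) (Fin k) ℂ) (f : mulDomain B) :
    mulFun B f =ᵐ[volume] fun x => act (B x) ((f : L2 d k) x) :=
  MemLp.coeFn_toLp _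

/-- Multiplication by a matrix-function `B` on its maximal domain. -/
def mulOp {d k : ℕ} (B : Sp d → Matrix (Fin k) (Fin k) ℂ) : L2 d k →ₗ.[ℂ] L2 d k where
  domain := mulDomain B
  toFun :=
    { toFun := mulFun B
      map_add' := by
        intro f g
        apply Lp.ext
        filter_upwards [coeFn_mulFun B f, coeFn_mulFun B g, coeFn_mulFun B (f + g),
          Lp.coeFn_add (f : L2 d k) (g : L2 d k), Lp.coeFn_add (mulFun B f) (mulFun B g)]
          with x h1 h2 h3 h4 h5
        rw [h5, Pi.add_apply, h1, h2, h3, Submodule.coe_add, h4, Pi.add_apply, map_add]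
      map_smul' := by
        intro c f
        apply Lp.ext
        filter_upwards [coeFn_mulFun B f, coeFn_mulFun B (c • f),
          Lp.coeFn_smul c (f : L2 d k), Lp.coeFn_smul c (mulFun B f)]
          with x h1 h2 h3 h4
        rw [RingHom.id_apply, h4, Pi.smul_apply, h1, h2, Submodule.coe_smul, h3, Pi.smul_apply,
          map_smul] }

/-- The operator `P(D) = Φ* A Φ` with symbol `A(ξ)`, on the domain of all `f` with
`A (Φ f) ∈ L₂`. Here `(Φ f)(ξ) = (2π)^(-d/2) ∫ exp(-i⟨x, ξ⟩) f(x) dx`. Since Mathlib's Fourier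
transform `𝓕` on `L₂` has the kernel `exp(-2πi⟨x, ξ⟩)`, the operator `Φ* A Φ` is the same as
`𝓕⁻¹ A(2π ·) 𝓕`. -/
def pseudoDiffOp {d k : ℕ} (A : Sp d → Matrix (Fin k) (Fin k) ℂ) : L2 d k →ₗ.[ℂ] L2 d k where
  domain := (mulOp fun ξ => A ((2 * Real.pi) • ξ)).domain.comap
    (Lp.fourierTransformₗᵢ (Sp d) (EuclideanSpace ℂ (Fin k))).toLinearEquiv.toLinearMap
  toFun :=
    (Lp.fourierTransformₗᵢ (Sp d) (EuclideanSpace ℂ (Fin k))).symm.toLinearEquiv.toLinearMap ∘ₗ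
      (mulOp fun ξ => A ((2 * Real.pi) • ξ)).toFun ∘ₗ
      (Lp.fourierTransformₗᵢ (Sp d) (EuclideanSpace ℂ (Fin k))).toLinearEquiv.toLinearMap.restrict
        (fun _ hf => Submodule.mem_comap.1 hf)

/-- `ν(ξ) = min_{|n| = 1} |A(ξ) n|`. -/
def nu {d k : ℕ} (A : Sp d → Matrix (Fin k) (Fin k) ℂ) (ξ : Sp d) : ℝ :=
  ⨅ n : Metric.sphere (0 : EuclideanSpace ℂ (Fin k)) 1, ‖act (A ξ) n‖

/-- `P(D)` is strongly Carleman: `ν(ξ) → ∞` as `|ξ| → ∞`. -/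
def StronglyCarleman {d k : ℕ} (A : Sp d → Matrix (Fin k) (Fin k) ℂ) : Prop :=
  Tendsto (nu A) (cobounded (Sp d)) atTop

/-! ### The medium and the weighted Hilbert space -/

/-- A measurable Hermitian matrix-function `M` with `0 < c₀ ≤ M(x) ≤ c₁ < ∞`. -/
structure Medium (d k : ℕ) where
  /-- the matrix `M(x)` -/
  mat : Sp d → Matrix (Fin k) (Fin k) ℂ
  aemeasurable : ∀ i j, AEMeasurable (fun x => mat x i j) volume
  isHermitian : ∀ x, (mat x).IsHermitian
  bounds : ∃ c₀ c₁ : ℝ, 0 < c₀ ∧ ∀ x,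
    (mat x - (c₀ : ℂ) • (1 : Matrix (Fin k) (Fin k) ℂ)).PosSemidef ∧
    ((c₁ : ℂ) • (1 : Matrix (Fin k) (Fin k) ℂ) - mat x).PosSemidef

section Helpers

variable {d k : ℕ}

theorem memLp_act {B : Sp d → Matrix (Fin k) (Fin k) ℂ}
    (hB : ∀ i j, AEMeasurable (fun x => B x i j) volume) {C : ℝ}
    (hC : ∀ x v, ‖act (B x) v‖ ≤ C * ‖v‖) (f : L2 d k) :
    MemLp (fun x => act (B x) (f x)) 2 volume := by
  refine MemLp.of_le_mul (c := C) (Lp.memLp f) ?_ (Eventually.of_forall fun x => hC x (f x))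
  have hf : AEMeasurable (f : Sp d → EuclideanSpace ℂ (Fin k)) volume :=
    (Lp.aestronglyMeasurable f).aemeasurable
  have h1 : AEMeasurable (fun x => (fun i => ∑ j, B x i j * (f x) j : Fin k → ℂ)) volume := by
    refine aemeasurable_pi_lambda _ fun i => ?_
    refine Finset.aemeasurable_fun_sum _ fun j _ => (hB i j).mul ?_
    exact (EuclideanSpace.proj (𝕜 := ℂ) j).continuous.measurable.comp_aemeasurable hf
  have h2 : AEMeasurable (fun x => act (B x) (f x)) volume :=
    (PiLp.continuous_toLp 2 (fun _ : Fin k => ℂ)).measurable.comp_aemeasurable h1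
  exact h2.aestronglyMeasurable

theorem inner_act_self_re_nonneg {B : Matrix (Fin k) (Fin k) ℂ} (h : B.PosSemidef)
    (v : EuclideanSpace ℂ (Fin k)) : 0 ≤ RCLike.re (inner ℂ v (act B v)) := by
  have := (Matrix.isPositive_toEuclideanLin_iff.2 h).2 v
  rw [inner_re_symm] at this
  exact this

theorem act_sub_smul_one (B : Matrix (Fin k) (Fin k) ℂ) (c : ℂ) (v : EuclideanSpace ℂ (Fin k)) :
    act (B - c • 1) v = act B v - c • v := by
  simp [act]

theorem act_smul_one_sub (B : Matrix (Fin k) (Fin k) ℂ) (c : ℂ) (v : EuclideanSpace ℂ (Fin k)) :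
    act (c • 1 - B) v = c • v - act B v := by
  simp [act]

theorem re_inner_smul_self (c : ℝ) (v : EuclideanSpace ℂ (Fin k)) :
    RCLike.re (inner ℂ v ((c : ℂ) • v)) = c * ‖v‖ ^ 2 := by
  rw [inner_smul_right, ← inner_self_eq_norm_sq (𝕜 := ℂ) v]
  exact Complex.re_ofReal_mul c _

theorem inner_act_ge {B : Matrix (Fin k) (Fin k) ℂ} {c : ℝ}
    (h : (B - (c : ℂ) • (1 : Matrix (Fin k) (Fin k) ℂ)).PosSemidef)
    (v : EuclideanSpace ℂ (Fin k)) :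
    c * ‖v‖ ^ 2 ≤ RCLike.re (inner ℂ v (act B v)) := by
  have := inner_act_self_re_nonneg h v
  rw [act_sub_smul_one, inner_sub_right, map_sub, re_inner_smul_self] at this
  linarith

theorem norm_act_ge {B : Matrix (Fin k) (Fin k) ℂ} {c : ℝ}
    (h : (B - (c : ℂ) • (1 : Matrix (Fin k) (Fin k) ℂ)).PosSemidef)
    (v : EuclideanSpace ℂ (Fin k)) : c * ‖v‖ ≤ ‖act B v‖ := by
  rcases eq_or_ne v 0 with rfl | hv
  · simp
  · have h1 := inner_act_ge h v
    have h2 := (RCLike.re_le_norm (inner ℂ v (act B v))).trans (norm_inner_le_norm v (act B v))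
    have h3 : 0 < ‖v‖ := norm_pos_iff.2 hv
    nlinarith

theorem inner_act_symm {B : Matrix (Fin k) (Fin k) ℂ} (h : B.IsHermitian)
    (v w : EuclideanSpace ℂ (Fin k)) : inner ℂ (act B v) w = inner ℂ v (act B w) :=
  (Matrix.isSymmetric_toEuclideanLin_iff.2 h) v w

namespace Medium

variable (M : Medium d k)

theorem exists_norm_act_le : ∃ C : ℝ, ∀ x v, ‖act (M.mat x) v‖ ≤ C * ‖v‖ := by
  obtain ⟨c₀, c₁, hc₀, h⟩ := M.bounds
  refine ⟨max c₁ 0, fun x v => ?_⟩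
  have hpos : (0 : EuclideanSpace ℂ (Fin k) →L[ℂ] EuclideanSpace ℂ (Fin k)) ≤ act (M.mat x) := by
    rw [ContinuousLinearMap.nonneg_iff_isPositive]
    refine ⟨fun v w => inner_act_symm (M.isHermitian x) v w, fun v => ?_⟩
    have := inner_act_ge (h x).1 v
    rw [inner_re_symm] at this
    exact le_trans (by positivity) this
  have hle : act (M.mat x) ≤ algebraMap ℝ _ (max c₁ 0) := by
    rw [ContinuousLinearMap.le_def]
    refine ⟨fun v w => ?_, fun v => ?_⟩
    · have := inner_act_symm (M.isHermitian x) v w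
      simp_all [inner_sub_left, inner_sub_right, Algebra.algebraMap_eq_smul_one]
    · have h1 := inner_act_self_re_nonneg (h x).2 v
      rw [act_smul_one_sub, inner_re_symm] at h1
      have h2 : c₁ * ‖v‖ ^ 2 ≤ max c₁ 0 * ‖v‖ ^ 2 := by gcongr; exact le_max_left _ _
      rw [inner_sub_left, map_sub] at h1
      simp only [ContinuousLinearMap.reApplyInnerSelf]
      rw [sub_apply, inner_sub_left, map_sub]
      have h3 : RCLike.re (inner ℂ ((c₁ : ℂ) • v) v) = c₁ * ‖v‖ ^ 2 := by
        rw [inner_re_symm, re_inner_smul_self]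
      have h4 : RCLike.re (inner ℂ ((algebraMap ℝ (EuclideanSpace ℂ (Fin k) →L[ℂ]
          EuclideanSpace ℂ (Fin k)) (max c₁ 0)) v) v) = max c₁ 0 * ‖v‖ ^ 2 := by
        rw [Algebra.algebraMap_eq_smul_one, smul_apply,
          one_apply_eq_self, inner_smul_left_eq_smul, inner_self_eq_norm_sq_to_K]
        norm_cast
      linarith
  have := (CStarAlgebra.norm_le_iff_le_algebraMap (act (M.mat x)) (le_max_right c₁ 0) hpos).2 hle
  exact (act (M.mat x)).le_of_opNorm_le this v

theorem isUnit_det (x : Sp d) : IsUnit (M.mat x).det := by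
  obtain ⟨c₀, c₁, hc₀, h⟩ := M.bounds
  rw [← Matrix.isUnit_iff_isUnit_det, ← Matrix.mulVec_injective_iff_isUnit]
  intro v w hvw
  have h1 := norm_act_ge (h x).1 (WithLp.toLp 2 (v - w))
  have h2 : act (M.mat x) (WithLp.toLp 2 (v - w)) = 0 := by
    rw [act, Matrix.toEuclideanCLM_toLp, Matrix.mulVec_sub, hvw, sub_self, WithLp.toLp_zero]
  rw [h2, norm_zero] at h1
  have h3 : WithLp.toLp 2 (v - w) = 0 := by
    rw [← norm_eq_zero]
    nlinarith [norm_nonneg (WithLp.toLp 2 (v - w))]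
  have h4 : v - w = 0 := (WithLp.toLp_eq_zero 2).1 h3
  exact sub_eq_zero.1 h4

theorem exists_norm_act_inv_le : ∃ C : ℝ, ∀ x v, ‖act ((M.mat x)⁻¹) v‖ ≤ C * ‖v‖ := by
  obtain ⟨c₀, c₁, hc₀, h⟩ := M.bounds
  refine ⟨c₀⁻¹, fun x v => ?_⟩
  have h1 := norm_act_ge (h x).1 (act ((M.mat x)⁻¹) v)
  have h2 : act (M.mat x) (act ((M.mat x)⁻¹) v) = v := by
    rw [← mul_apply_eq_comp, act, act, ← map_mul,
      Matrix.mul_nonsing_inv _ (M.isUnit_det x), map_one, one_apply_eq_self]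
  rw [h2] at h1
  rwa [inv_mul_eq_div, le_div_iff₀' hc₀]

theorem aemeasurable_inv (i j : Fin k) : AEMeasurable (fun x => (M.mat x)⁻¹ i j) volume := by
  have hM : AEMeasurable (fun x => (fun i j => M.mat x i j : Fin k → Fin k → ℂ)) volume :=
    aemeasurable_pi_lambda _ fun i => aemeasurable_pi_lambda _ fun j => M.aemeasurable i j
  have hof : Continuous fun B : Fin k → Fin k → ℂ => (Matrix.of B) := continuous_id
  have hdet : Measurable fun B : Fin k → Fin k → ℂ => (Matrix.of B).det :=
    hof.matrix_det.measurable
  have hadj : Measurable fun B : Fin k → Fin k → ℂ => (Matrix.of B).adjugate i j :=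
    (hof.matrix_adjugate.matrix_elem i j).measurable
  have := (hdet.inv.mul hadj).comp_aemeasurable hM
  refine this.congr (Eventually.of_forall fun x => ?_)
  simp only [Function.comp, Pi.mul_apply, Pi.inv_apply, Matrix.inv_def, Matrix.smul_apply,
    Ring.inverse_eq_inv', smul_eq_mul]
  rfl

end Medium

end Helpers

/-- Multiplication by `M(x)⁻¹`, an everywhere defined operator. -/
def Medium.mulInv {d k : ℕ} (M : Medium d k) : L2 d k →ₗ[ℂ] L2 d k :=
  (mulOp fun x => (M.mat x)⁻¹).toFun ∘ₗ
    LinearMap.codRestrict _ LinearMap.id (fun f =>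
      memLp_act M.aemeasurable_inv M.exists_norm_act_inv_le.choose_spec f)

/-- The Hilbert space `𝓗` attached to `M`: it consists of the same elements as `L₂(ℝᵈ; ℂᵏ)`, its
scalar product is `∫ ⟨M(x) f(x), g(x)⟩ dx`. -/
structure WeightedL2 {d k : ℕ} (M : Medium d k) where
  /-- an element of `L₂(ℝᵈ; ℂᵏ)`, considered as an element of `𝓗` -/
  ofL2 ::
  /-- the underlying element of `L₂(ℝᵈ; ℂᵏ)` -/
  elem : L2 d k

namespace WeightedL2

variable {d k : ℕ} (M : Medium d k)

/-- The identical mapping of `𝓗` onto `L₂(ℝᵈ; ℂᵏ)`, as a bijection. -/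
def equivL2 : WeightedL2 M ≃ L2 d k where
  toFun := elem
  invFun := ofL2
  left_inv _ := rfl
  right_inv _ := rfl

instance : AddCommGroup (WeightedL2 M) := (equivL2 M).addCommGroup

instance : Module ℂ (WeightedL2 M) := (equivL2 M).module ℂ

/-- The identical mapping of `𝓗` onto `L₂(ℝᵈ; ℂᵏ)`, as a linear isomorphism. -/
def toL2 : WeightedL2 M ≃ₗ[ℂ] L2 d k := (equivL2 M).linearEquiv ℂ

/-- The weighted scalar product `∫ ⟨M(x) f(x), g(x)⟩ dx`; in Mathlib's convention it is
conjugate-linear in the first argument. -/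
def weightedInner (f g : L2 d k) : ℂ := ∫ x, inner ℂ (f x) (act (M.mat x) (g x))

theorem integrable_weightedInner (f g : L2 d k) :
    Integrable (fun x => inner ℂ (f x) (act (M.mat x) (g x))) volume := by
  have h := memLp_act M.aemeasurable M.exists_norm_act_le.choose_spec g
  refine (L2.integrable_inner (𝕜 := ℂ) f (h.toLp _)).congr ?_
  filter_upwards [h.coeFn_toLp] with x hx
  rw [hx]

theorem re_weightedInner_self (f : L2 d k) : RCLike.re (weightedInner M f f) =
    ∫ x, RCLike.re (inner ℂ (f x) (act (M.mat x) (f x))) :=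
  (integral_re (integrable_weightedInner M f f)).symm

theorem re_inner_act_nonneg (x : Sp d) (v : EuclideanSpace ℂ (Fin k)) :
    0 ≤ RCLike.re (inner ℂ v (act (M.mat x) v)) := by
  obtain ⟨c₀, c₁, hc₀, h⟩ := M.bounds
  exact le_trans (by positivity) (inner_act_ge (h x).1 v)

/-- The weighted scalar product satisfies the axioms of a scalar product. -/
abbrev core : InnerProductSpace.Core ℂ (WeightedL2 M) where
  inner f g := weightedInner M (toL2 M f) (toL2 M g)
  conj_inner_symm f g := by
    rw [weightedInner, weightedInner, ← integral_conj]
    refine integral_congr_ae (Eventually.of_forall fun x => ?_)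
    simp only
    rw [inner_conj_symm, inner_act_symm (M.isHermitian x)]
  re_inner_nonneg f := by
    rw [re_weightedInner_self]
    exact integral_nonneg fun x => re_inner_act_nonneg M x _
  add_left f g h := by
    rw [weightedInner, weightedInner, weightedInner, ← integral_add
      (integrable_weightedInner M _ _) (integrable_weightedInner M _ _), map_add]
    refine integral_congr_ae ?_
    filter_upwards [Lp.coeFn_add (toL2 M f) (toL2 M g)] with x hx
    rw [hx, Pi.add_apply, inner_add_left]
  smul_left f g c := by
    rw [weightedInner, weightedInner, ← integral_const_mul, map_smul]
    refine integral_congr_ae ?_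
    filter_upwards [Lp.coeFn_smul c (toL2 M f)] with x hx
    rw [hx, Pi.smul_apply, inner_smul_left]
  definite f hf := by
    have h0 := re_weightedInner_self M (toL2 M f)
    rw [hf, map_zero, eq_comm, integral_eq_zero_iff_of_nonneg
      (fun x => re_inner_act_nonneg M x _) (integrable_weightedInner M _ _).re] at h0
    obtain ⟨c₀, c₁, hc₀, h⟩ := M.bounds
    have h1 : toL2 M f = 0 := by
      rw [Lp.eq_zero_iff_ae_eq_zero]
      filter_upwards [h0] with x hx
      have h2 := inner_act_ge (h x).1 (toL2 M f x)
      rw [hx, Pi.zero_apply] at h2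
      have h3 : ‖toL2 M f x‖ ^ 2 ≤ 0 := by
        by_contra! h4
        have := mul_pos hc₀ h4
        linarith
      rw [Pi.zero_apply, ← norm_eq_zero]
      exact pow_eq_zero_iff two_ne_zero |>.1 (le_antisymm h3 (by positivity))
    exact (toL2 M).map_eq_zero_iff.1 h1

instance : NormedAddCommGroup (WeightedL2 M) :=
  (core M).toNormedAddCommGroup

instance : InnerProductSpace ℂ (WeightedL2 M) :=
  InnerProductSpace.ofCore (core M).toCore

end WeightedL2

/-- The operator `H = M⁻¹ P(D)` in the space `𝓗`, with the domain `𝓓(H) = 𝓓(P(D))`. -/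
def mediumOp {d k : ℕ} (M : Medium d k) (A : Sp d → Matrix (Fin k) (Fin k) ℂ) :
    WeightedL2 M →ₗ.[ℂ] WeightedL2 M where
  domain := (pseudoDiffOp A).domain.comap (WeightedL2.toL2 M).toLinearMap
  toFun := (WeightedL2.toL2 M).symm.toLinearMap ∘ₗ M.mulInv ∘ₗ (pseudoDiffOp A).toFun ∘ₗ
    (WeightedL2.toL2 M).toLinearMap.restrict (fun _ hf => Submodule.mem_comap.1 hf)

end MediumScattering

end

noncomputable section

/-! Both operators are self-adjoint in their own weighted spaces: `M H = P(D)`, and the scalar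
product of `𝓗` is `(f, M g)` in `L₂`, so self-adjointness of `H` reduces to that of `P(D)`, a
multiplication operator conjugated by the Fourier transform. For self-adjoint operators on separable
spaces Weyl's criterion holds (`IsSelfAdjointOp.notMem_essentialSpectrum_iff`): `z` lies outside the
essential spectrum exactly when bounded weakly null sequences with `(T - z) f n → 0` tend to zero in
norm. Both implications pass through `HasSpectralGap`.

This criterion transfers between the two spaces. The identical mappings onto `L₂` are
homeomorphisms, and after multiplication by `M` the condition `(H - z) f n → 0` reads `P(D) f n - z
M f n → 0`. Replacing `M` by `M₀` changes the left side by `z (M - M₀) f n`, so it is enough that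
this term tends to zero (`tendsto_mulMat_sub`).

Along such a sequence `P(D) f n` is bounded. By the Carleman condition the high frequencies of `f n`
are then uniformly small. The low frequencies tend to zero pointwise, by weak convergence, and hence
in `L₂` on bounded sets, by dominated convergence. Thus `f n → 0` locally, while `M - M₀` is small
outside a large ball. -/

namespace MediumScattering

/-! ### Essential spectrum of a self-adjoint operator and singular sequences -/

section SelfAdjoint

variable {E : Type*} [NormedAddCommGroup E] [InnerProductSpace ℂ E]

/-- A symmetric operator which contains its adjoint. -/
structure IsSelfAdjointOp (T : E →ₗ.[ℂ] E) : Prop where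
  symm : ∀ f g : T.domain, inner ℂ (T f) (g : E) = inner ℂ (f : E) (T g)
  mem_of_adjoint : ∀ g h : E, (∀ f : T.domain, inner ℂ (T f) g = inner ℂ (f : E) h) →
    ∃ hg : g ∈ T.domain, T ⟨g, hg⟩ = h

/-- Weak convergence of a sequence. -/
def WeakTendsto {E : Type*} [NormedAddCommGroup E] [NormedSpace ℂ E] (f : ℕ → E) (x : E) : Prop :=
  ∀ φ : E →L[ℂ] ℂ, Tendsto (fun n => φ (f n)) atTop (𝓝 (φ x))

/-- Every bounded weakly null sequence with `(T - z) f n → 0` converges to zero in norm. -/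
def NoSingularSequence {E : Type*} [NormedAddCommGroup E] [NormedSpace ℂ E] (T : E →ₗ.[ℂ] E)
    (z : ℂ) : Prop :=
  ∀ f : ℕ → T.domain, (∃ C : ℝ, ∀ n, ‖(f n : E)‖ ≤ C) → WeakTendsto (fun n => (f n : E)) 0 →
    Tendsto (fun n => T (f n) - z • (f n : E)) atTop (𝓝 0) →
    Tendsto (fun n => (f n : E)) atTop (𝓝 0)

/-- The eigenspace is finite dimensional, and the distance to it is controlled by `T - z`. -/
def HasSpectralGap (T : E →ₗ.[ℂ] E) (z : ℂ) : Prop :=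
  FiniteDimensional ℂ (eigenspace T z) ∧ ∃ C : ℝ, ∀ f : T.domain, ∃ n ∈ eigenspace T z,
    ‖(f : E) - n‖ ≤ C * ‖T f - z • (f : E)‖

theorem weakTendsto_of_tendsto {f : ℕ → E} {x : E} (h : Tendsto f atTop (𝓝 x)) :
    WeakTendsto f x := fun φ => (φ.continuous.tendsto x).comp h

theorem WeakTendsto.inner {f : ℕ → E} {x : E} (h : WeakTendsto f x) (g : E) :
    Tendsto (fun n => inner ℂ g (f n)) atTop (𝓝 (inner ℂ g x)) := h (innerSL ℂ g)

theorem weakTendsto_of_inner [CompleteSpace E] {f : ℕ → E} {x : E}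
    (h : ∀ g, Tendsto (fun n => inner ℂ g (f n)) atTop (𝓝 (inner ℂ g x))) : WeakTendsto f x := by
  intro φ
  obtain ⟨g, rfl⟩ := (InnerProductSpace.toDual ℂ E).surjective φ
  simpa using h g

theorem WeakTendsto.sub {f g : ℕ → E} {x y : E} (hf : WeakTendsto f x) (hg : WeakTendsto g y) :
    WeakTendsto (fun n => f n - g n) (x - y) := by
  intro φ
  simpa using (hf φ).sub (hg φ)

theorem WeakTendsto.add {f g : ℕ → E} {x y : E} (hf : WeakTendsto f x) (hg : WeakTendsto g y) :
    WeakTendsto (fun n => f n + g n) (x + y) := by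
  intro φ
  simpa using (hf φ).add (hg φ)

theorem WeakTendsto.const_smul {f : ℕ → E} {x : E} (hf : WeakTendsto f x) (c : ℂ) :
    WeakTendsto (fun n => c • f n) (c • x) := by
  intro φ
  simpa using (hf φ).const_mul c

/-- Sequential Banach–Alaoglu in the dual, carried back by the Riesz isomorphism. The dual pairing
has the sequence in the first slot of the scalar product, hence the conjugation at the end. -/
theorem exists_subseq_weakTendsto [CompleteSpace E] [TopologicalSpace.SeparableSpace E]
    {f : ℕ → E} {C : ℝ} (hf : ∀ n, ‖f n‖ ≤ C) :
    ∃ (x : E) (φ : ℕ → ℕ), StrictMono φ ∧ WeakTendsto (fun n => f (φ n)) x := by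
  obtain ⟨a, -, φ, hφ, ha⟩ := WeakDual.isSeqCompact_closedBall ℂ E 0 C
    (x := fun n => StrongDual.toWeakDual (InnerProductSpace.toDual ℂ E (f n)))
    (fun n => by
      change InnerProductSpace.toDual ℂ E (f n) ∈ Metric.closedBall 0 C
      simpa using hf n)
  obtain ⟨x, hx⟩ := (InnerProductSpace.toDual ℂ E).surjective (WeakDual.toStrongDual a)
  refine ⟨x, φ, hφ, weakTendsto_of_inner fun g => ?_⟩
  have h1 := ((WeakDual.eval_continuous g).tendsto a).comp ha
  have h2 : a g = inner ℂ x g := by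
    have : WeakDual.toStrongDual a g = inner ℂ x g := by rw [← hx]; simp
    exact this
  rw [h2] at h1
  have h3 := (Complex.continuous_conj.tendsto _).comp h1
  rw [inner_conj_symm] at h3
  refine h3.congr fun n => ?_
  exact inner_conj_symm _ _

theorem eigenspace_eq_bot_of_bounded_below {T : E →ₗ.[ℂ] E} {z : ℂ} {c : ℝ} (hc : 0 < c)
    (h : ∀ f : T.domain, c * ‖(f : E)‖ ≤ ‖T f - z • (f : E)‖) : eigenspace T z = ⊥ := by
  rw [eq_bot_iff]
  rintro f ⟨hf, hf'⟩
  have h1 := h ⟨f, hf⟩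
  rw [hf'] at h1
  simp only [sub_self, norm_zero] at h1
  exact norm_eq_zero.1 (le_antisymm (by nlinarith [norm_nonneg f]) (norm_nonneg _))

/-! ### Weak closedness and regular points -/

namespace IsSelfAdjointOp

variable {T : E →ₗ.[ℂ] E} (hT : IsSelfAdjointOp T)

include hT

/-- Symmetry moves the operator onto the test vector, so the weak limits satisfy the identity that
defines the adjoint, and `T` contains its adjoint. -/
theorem closed_weak {f : ℕ → T.domain} {x y : E} (hx : WeakTendsto (fun n => (f n : E)) x)
    (hy : WeakTendsto (fun n => T (f n)) y) : ∃ h : x ∈ T.domain, T ⟨x, h⟩ = y := by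
  refine hT.mem_of_adjoint x y fun g => ?_
  refine tendsto_nhds_unique (hx.inner (T g)) ((hy.inner (g : E)).congr fun n => ?_)
  rw [hT.symm]

theorem mem_eigenspace_of_weakTendsto {f : ℕ → T.domain} {x : E} {z : ℂ}
    (hx : WeakTendsto (fun n => (f n : E)) x)
    (hy : Tendsto (fun n => T (f n) - z • (f n : E)) atTop (𝓝 0)) : x ∈ eigenspace T z := by
  refine hT.closed_weak hx ?_
  have := (weakTendsto_of_tendsto hy).add (hx.const_smul z)
  simpa using this

/-- The lower bound makes `T - z` injective with closed range. The orthogonal complement of the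
range is contained in the eigenspace at the conjugate of `z`, so the range is everything. -/
theorem isRegularPoint_of_bounded_below [CompleteSpace E] {z : ℂ} {c : ℝ} (hc : 0 < c)
    (h : ∀ f : T.domain, c * ‖(f : E)‖ ≤ ‖T f - z • (f : E)‖)
    (h' : eigenspace T (starRingEnd ℂ z) = ⊥) : IsRegularPoint T z := by
  let S : T.domain →ₗ[ℂ] E := T.toFun - z • T.domain.subtype
  have hS : ∀ f, S f = T f - z • (f : E) := fun f => rfl
  have hinj : Function.Injective S := by
    rw [← LinearMap.ker_eq_bot, LinearMap.ker_eq_bot']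
    intro f hf
    have h1 := h f
    rw [← hS, hf, norm_zero] at h1
    have h2 : ‖(f : E)‖ = 0 := le_antisymm (by nlinarith [norm_nonneg (f : E)]) (norm_nonneg _)
    exact Subtype.ext (norm_eq_zero.1 h2)
  have hclosed : IsClosed (LinearMap.range S : Set E) := by
    rw [← isSeqClosed_iff_isClosed]
    intro u y hu huy
    choose f hf using hu
    have hc1 : CauchySeq (fun n => (f n : E)) := by
      have hcu := huy.cauchySeq
      rw [Metric.cauchySeq_iff] at hcu ⊢
      intro ε hε
      obtain ⟨N, hN⟩ := hcu (c * ε) (by positivity)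
      refine ⟨N, fun m hm n hn => ?_⟩
      have h1 := hN m hm n hn
      have h2 := h (f m - f n)
      rw [← hS, map_sub, hf, hf] at h2
      rw [dist_eq_norm] at h1 ⊢
      exact lt_of_mul_lt_mul_left (h2.trans_lt h1) hc.le
    obtain ⟨x, hx⟩ := cauchySeq_tendsto_of_complete hc1
    have hTf : Tendsto (fun n => T (f n)) atTop (𝓝 (y + z • x)) := by
      refine (huy.add (hx.const_smul z)).congr fun n => ?_
      rw [← hf, hS]; abel
    obtain ⟨hxD, hTx⟩ := hT.closed_weak (weakTendsto_of_tendsto hx) (weakTendsto_of_tendsto hTf)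
    refine ⟨⟨x, hxD⟩, ?_⟩
    rw [hS, hTx]; simp
  have hsurj : LinearMap.range S = ⊤ := by
    have : CompleteSpace (LinearMap.range S) := hclosed.completeSpace_coe
    rw [← Submodule.orthogonal_eq_bot_iff, ← le_bot_iff, ← h']
    intro g hg
    refine hT.mem_of_adjoint g _ fun f => ?_
    have h1 : inner ℂ (S f) g = 0 := (Submodule.mem_orthogonal _ _).1 hg _ ⟨f, rfl⟩
    rw [hS, inner_sub_left, inner_smul_left, sub_eq_zero] at h1
    rw [h1, inner_smul_right]
  let e := LinearEquiv.ofBijective S ⟨hinj, LinearMap.range_eq_top.1 hsurj⟩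
  have he : ∀ y, T (e.symm y) - z • (e.symm y : E) = y := fun y => by
    rw [← hS]; exact e.apply_symm_apply y
  refine ⟨(T.domain.subtype ∘ₗ e.symm.toLinearMap).mkContinuous c⁻¹ fun y => ?_, fun y => ?_,
    fun x => ?_⟩
  · have h1 := h (e.symm y)
    rw [he] at h1
    rw [inv_mul_eq_div, le_div_iff₀' hc]
    exact h1
  · exact ⟨(e.symm y).2, he y⟩
  · have : e.symm (S x) = x := e.symm_apply_apply x
    rw [← hS]
    change ((e.symm (S x) : T.domain) : E) = x
    rw [this]

/-- Since `(f, T f)` is real, the imaginary part of `(f, (T - z) f)` is `-z.im * ‖f‖ ^ 2`;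
Cauchy–Schwarz does the rest. -/
theorem im_bound (z : ℂ) (f : T.domain) : |z.im| * ‖(f : E)‖ ≤ ‖T f - z • (f : E)‖ := by
  rcases eq_or_ne (f : E) 0 with hf | hf
  · rw [hf]; simp
  have h1 : (inner ℂ (f : E) (T f)).im = 0 := by
    rw [← Complex.conj_eq_iff_im, inner_conj_symm, hT.symm]
  have h2 : inner ℂ (f : E) (T f - z • (f : E)) =
      inner ℂ (f : E) (T f) - z * (‖(f : E)‖ ^ 2 : ℝ) := by
    rw [inner_sub_right, inner_smul_right, inner_self_eq_norm_sq_to_K]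
    norm_cast
  have h3 : |z.im| * ‖(f : E)‖ ^ 2 ≤ ‖(f : E)‖ * ‖T f - z • (f : E)‖ := by
    refine le_trans (le_of_eq ?_)
      ((Complex.abs_im_le_norm _).trans (norm_inner_le_norm (𝕜 := ℂ) _ _))
    rw [h2, Complex.sub_im, h1, Complex.im_mul_ofReal, zero_sub, abs_neg, abs_mul,
      abs_of_nonneg (by positivity : 0 ≤ ‖(f : E)‖ ^ 2)]
  have h4 : 0 < ‖(f : E)‖ := norm_pos_iff.2 hf
  nlinarith

theorem isRegularPoint_of_im_ne_zero [CompleteSpace E] {z : ℂ} (hz : z.im ≠ 0) :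
    IsRegularPoint T z := by
  refine hT.isRegularPoint_of_bounded_below (abs_pos.2 hz) (hT.im_bound z) ?_
  refine eigenspace_eq_bot_of_bounded_below (abs_pos.2 hz) fun f => ?_
  simpa using hT.im_bound (starRingEnd ℂ z) f

end IsSelfAdjointOp

/-! ### Isolated spectral points and the spectral gap -/

/-- If `μ` is not an accumulation point of the spectrum of a bounded self-adjoint operator `B`, then
`B - μ` has a generalized inverse. -/
theorem exists_generalized_inverse [CompleteSpace E] {B : E →L[ℂ] E} (hB : IsSelfAdjoint B) {μ : ℂ}
    (hμ : ∀ᶠ t in 𝓝[≠] μ, t ∉ spectrum ℂ B) :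
    ∃ G : E →L[ℂ] E, (B - algebraMap ℂ _ μ) * G * (B - algebraMap ℂ _ μ) =
      B - algebraMap ℂ _ μ := by
  have hn : IsStarNormal B := hB.isStarNormal
  have hcont : ContinuousOn (fun t : ℂ => (t - μ)⁻¹) (spectrum ℂ B) := by
    intro t ht
    by_cases h : t = μ
    · subst h
      -- Within the spectrum `μ` is isolated, so any value there, here `0⁻¹ = 0`, keeps the function
      -- continuous.
      have h1 : 𝓝[spectrum ℂ B] t ≤ pure t := by
        rw [eventually_nhdsWithin_iff] at hμ
        rw [nhdsWithin, le_pure_iff, mem_inf_principal]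
        filter_upwards [hμ] with s hs hs'
        by_contra hst
        exact hs hst hs'
      exact (tendsto_pure_nhds _ _).mono_left h1
    · exact ((continuousAt_id.sub continuousAt_const).inv₀ (sub_ne_zero.2 h)).continuousWithinAt
  have hid : cfc (fun t : ℂ => t - μ) B = B - algebraMap ℂ _ μ := by
    rw [cfc_sub _ _ B, cfc_id' ℂ B, cfc_const μ B]
  refine ⟨cfc (fun t : ℂ => (t - μ)⁻¹) B, ?_⟩
  rw [← hid, ← cfc_mul _ _ B, ← cfc_mul _ _ B]
  refine cfc_congr fun t _ => ?_
  -- The identity `s * s⁻¹ * s = s` also holds at `s = 0`, which is why the inverse is only a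
  -- generalized one.
  exact mul_inv_mul_cancel (t - μ)

namespace IsRegularPoint

variable {T : E →ₗ.[ℂ] E}

theorem eigenspace_eq_bot {z : ℂ} (h : IsRegularPoint T z) : eigenspace T z = ⊥ := by
  obtain ⟨R, -, hR⟩ := h
  rw [eq_bot_iff]
  rintro f ⟨hf, hf'⟩
  have h1 := hR ⟨f, hf⟩
  rw [hf', sub_self, map_zero] at h1
  exact h1.symm

theorem hasSpectralGap {z : ℂ} (h : IsRegularPoint T z) : HasSpectralGap T z := by
  refine ⟨h.eigenspace_eq_bot ▸ inferInstance, ?_⟩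
  obtain ⟨R, -, hR⟩ := h
  refine ⟨‖R‖, fun f => ⟨0, zero_mem _, ?_⟩⟩
  rw [sub_zero]
  conv_lhs => rw [← hR f]
  exact R.le_opNorm _

end IsRegularPoint

/-- The resolvent identity. -/
theorem resolvent_sub_resolvent {T : E →ₗ.[ℂ] E} {w w' : ℂ} {R R' : E →L[ℂ] E}
    (hR : ∀ x : T.domain, R (T x - w • (x : E)) = x)
    (hR' : ∀ y : E, ∃ h : R' y ∈ T.domain, T ⟨R' y, h⟩ - w' • R' y = y) (y : E) :
    (w' - w) • R (R' y) = R' y - R y := by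
  obtain ⟨h, h1⟩ := hR' y
  have h2 := hR ⟨R' y, h⟩
  have h3 : T ⟨R' y, h⟩ - w • R' y = y + (w' - w) • R' y := by
    rw [sub_smul, sub_eq_iff_eq_add.1 h1]
    abel
  simp only [h3, map_add, map_smul] at h2
  exact eq_sub_of_add_eq' h2

/-- The sequence is asymptotic in norm to eigenvectors. These are weakly null in a
finite-dimensional space, hence null in norm. -/
theorem HasSpectralGap.noSingularSequence {T : E →ₗ.[ℂ] E} {z : ℂ}
    (hz : HasSpectralGap T z) : NoSingularSequence T z := by
  intro f _ hweak hlim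
  obtain ⟨hfin, C, hC⟩ := hz
  set N := eigenspace T z with hN
  choose n hnN hn using fun i => hC (f i)
  have h1 : Tendsto (fun i => (f i : E) - n i) atTop (𝓝 0) := by
    refine squeeze_zero_norm hn ?_
    simpa using hlim.norm.const_mul C
  have h2 : WeakTendsto n 0 := by
    simpa using hweak.sub (weakTendsto_of_tendsto h1)
  have h3 : Tendsto n atTop (𝓝 0) := by
    let b := stdOrthonormalBasis ℂ N
    have h4 : ∀ i, ∑ j, inner ℂ (b j : E) (n i) • (b j : E) = n i := fun i => by
      have := congrArg (Subtype.val) (b.sum_repr' ⟨n i, hnN i⟩)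
      simpa using this
    have h5 : Tendsto (fun i => ∑ j, inner ℂ (b j : E) (n i) • (b j : E)) atTop
        (𝓝 (∑ j, inner ℂ (b j : E) 0 • (b j : E))) :=
      tendsto_finsetSum _ fun j _ => (h2.inner _).smul_const _
    simpa [h4] using h5
  simpa using h1.add h3

namespace IsSelfAdjointOp

variable {T : E →ₗ.[ℂ] E} (hT : IsSelfAdjointOp T)

include hT

theorem resolvent_isSelfAdjoint [CompleteSpace E] {w : ℝ} {R : E →L[ℂ] E}
    (hR : ∀ y : E, ∃ h : R y ∈ T.domain, T ⟨R y, h⟩ - (w : ℂ) • R y = y) : IsSelfAdjoint R := by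
  rw [ContinuousLinearMap.isSelfAdjoint_iff_isSymmetric]
  intro x y
  change inner ℂ (R x) y = inner ℂ x (R y)
  obtain ⟨hx, hx'⟩ := hR x
  obtain ⟨hy, hy'⟩ := hR y
  have h := hT.symm ⟨R x, hx⟩ ⟨R y, hy⟩
  simp only at h
  conv_lhs => rw [← hy']
  conv_rhs => rw [← hx']
  rw [inner_sub_left, inner_sub_right, h, inner_smul_left, inner_smul_right, Complex.conj_ofReal]

/-- The resolvent `R` at a nearby real regular point `w` is bounded and self-adjoint. Under `t ↦ w +
t⁻¹` isolation of `z` becomes isolation of `μ = (z - w)⁻¹` for `R`, and the generalized inverse of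
`R - μ` supplies the estimate. -/
theorem hasSpectralGap_of_isolated [CompleteSpace E] {z : ℝ}
    (hfin : FiniteDimensional ℂ (eigenspace T z))
    (hiso : ∀ᶠ w in 𝓝[≠] (z : ℂ), w ∉ opSpectrum T) : HasSpectralGap T z := by
  refine ⟨hfin, ?_⟩
  have hiso' := hiso
  rw [eventually_nhdsWithin_iff, Metric.eventually_nhds_iff] at hiso'
  obtain ⟨ε, hε, hreg⟩ := hiso'
  have hreg' : ∀ w : ℂ, dist w z < ε → w ≠ z → IsRegularPoint T w := fun w h1 h2 =>
    not_not.1 (hreg h1 h2)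
  set w : ℝ := z + ε / 2 with hw
  have hwz : (w : ℂ) - z = (ε / 2 : ℝ) := by rw [hw]; push_cast; ring
  have hwz0 : (z : ℂ) - w ≠ 0 := by
    rw [← neg_ne_zero, neg_sub, hwz, Complex.ofReal_ne_zero]; positivity
  obtain ⟨R, hR1, hR2⟩ := hreg' w
    (by rw [dist_eq_norm, hwz, Complex.norm_real, Real.norm_of_nonneg (by positivity)]; linarith)
    (fun h => hwz0 (by rw [h, sub_self]))
  have hsa := hT.resolvent_isSelfAdjoint hR1
  set μ : ℂ := ((z : ℂ) - w)⁻¹ with hμ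
  have hμ0 : μ ≠ 0 := inv_ne_zero hwz0
  have hspec : ∀ᶠ t in 𝓝[≠] μ, t ∉ spectrum ℂ R := by
    have hcont : Tendsto (fun t : ℂ => (w : ℂ) + t⁻¹) (𝓝[≠] μ) (𝓝[≠] (z : ℂ)) := by
      refine tendsto_nhdsWithin_iff.2 ⟨?_, ?_⟩
      · have h1 : Tendsto (fun t : ℂ => (w : ℂ) + t⁻¹) (𝓝 μ) (𝓝 ((w : ℂ) + μ⁻¹)) :=
          tendsto_const_nhds.add (tendsto_inv₀ hμ0)
        rw [hμ, inv_inv, add_sub_cancel] at h1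
        exact h1.mono_left nhdsWithin_le_nhds
      · filter_upwards [self_mem_nhdsWithin] with t ht h
        apply ht
        rw [Set.mem_singleton_iff, hμ, ← inv_inv t]
        congr 1
        rw [← (h : (w : ℂ) + t⁻¹ = z)]; ring
    have h0 : ∀ᶠ t in 𝓝[≠] μ, t ≠ 0 := (eventually_ne_nhds hμ0).filter_mono nhdsWithin_le_nhds
    filter_upwards [hcont.eventually hiso, h0] with t ht ht0
    obtain ⟨R', hR1', hR2'⟩ := not_not.1 ht
    rw [spectrum.notMem_iff]
    have e1 : ∀ y, t⁻¹ • R (R' y) = R' y - R y := fun y => by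
      have := resolvent_sub_resolvent hR2 hR1' y
      rwa [add_sub_cancel_left] at this
    have e2 : ∀ y, t⁻¹ • R' (R y) = R' y - R y := fun y => by
      have := resolvent_sub_resolvent hR2' hR1 y
      rw [← neg_inj, ← neg_smul, neg_sub] at this
      simpa using this
    have e1' : ∀ y, R (R' y) = t • (R' y - R y) := fun y => by rw [← e1, smul_inv_smul₀ ht0]
    have e2' : ∀ y, R' (R y) = t • (R' y - R y) := fun y => by rw [← e2, smul_inv_smul₀ ht0]
    -- Formally `t - R = t (T - w - t⁻¹) R`, whose inverse is `t⁻¹ (T - w) R' = t⁻¹ (1 + t⁻¹ R')`.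
    refine isUnit_iff_exists.2 ⟨t⁻¹ • (1 + t⁻¹ • R'), ?_, ?_⟩
    · ext y
      simp only [mul_apply_eq_comp, sub_apply, smul_apply, add_apply, one_apply_eq_self,
        Algebra.algebraMap_eq_smul_one, map_smul, map_add, e1']
      match_scalars <;> field_simp <;> ring
    · ext y
      simp only [mul_apply_eq_comp, sub_apply, smul_apply, add_apply, one_apply_eq_self,
        Algebra.algebraMap_eq_smul_one, map_smul, map_sub, e2']
      match_scalars <;> field_simp <;> ring
  obtain ⟨G, hG⟩ := exists_generalized_inverse hsa hspec
  set Q : E →L[ℂ] E := R - algebraMap ℂ _ μ with hQ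
  have hQa : ∀ x, Q x = R x - μ • x := fun x => by
    simp [hQ, Algebra.algebraMap_eq_smul_one]
  have hker : ∀ x, Q x = 0 → x ∈ eigenspace T z := by
    intro x hx
    rw [hQa, sub_eq_zero] at hx
    have hx' : x = μ⁻¹ • R x := by rw [hx, inv_smul_smul₀ hμ0]
    obtain ⟨h1, h2⟩ := hR1 x
    have hxD : x ∈ T.domain := by rw [hx']; exact T.domain.smul_mem _ h1
    refine ⟨hxD, ?_⟩
    have h3 : (⟨x, hxD⟩ : T.domain) = μ⁻¹ • ⟨R x, h1⟩ := Subtype.ext hx'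
    rw [h3, T.map_smul, sub_eq_iff_eq_add.1 h2]
    rw [smul_add, smul_comm, ← hx', ← add_smul, hμ, inv_inv, sub_add_cancel]
  -- `Q G Q = Q` places `f - G Q f` in the kernel of `Q`, and the remainder `G Q f` is controlled
  -- because `Q f = -μ R (T - z) f`.
  refine ⟨‖G‖ * (‖μ‖ * ‖R‖), fun f => ⟨(f : E) - G (Q f), hker _ ?_, ?_⟩⟩
  · rw [map_sub, sub_eq_zero]
    exact (congrArg (fun L : E →L[ℂ] E => L f) hG).symm
  · rw [sub_sub_cancel]
    have h1 : Q f = -(μ • R (T f - (z : ℂ) • (f : E))) := by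
      have h2 := hR2 f
      have h3 : T f - (z : ℂ) • (f : E) = (T f - (w : ℂ) • (f : E)) - ((z : ℂ) - w) • (f : E) := by
        rw [sub_smul]; abel
      rw [h3, map_sub, h2, map_smul, smul_sub, hμ, inv_smul_smul₀ hwz0, hQa, neg_sub]
    rw [h1, map_neg, norm_neg, mul_assoc]
    refine (G.le_opNorm _).trans ?_
    gcongr
    rw [norm_smul, mul_assoc]
    gcongr
    exact R.le_opNorm _

theorem hasSpectralGap_of_notMem_essentialSpectrum [CompleteSpace E] {z : ℂ}
    (hz : z ∉ essentialSpectrum T) : HasSpectralGap T z := by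
  by_cases hreg : IsRegularPoint T z
  · exact hreg.hasSpectralGap
  have him : z.im = 0 := by
    by_contra h
    exact hreg (hT.isRegularPoint_of_im_ne_zero h)
  obtain ⟨x, rfl⟩ : ∃ x : ℝ, (x : ℂ) = z := ⟨z.re, Complex.ext rfl (by simp [him])⟩
  have h : IsIsolatedFiniteEigenvalue T x := by
    by_contra h
    exact hz ⟨hreg, h⟩
  exact hT.hasSpectralGap_of_isolated h.2.1 h.2.2

/-- If the eigenspace is trivial, the gap makes `z` regular. Otherwise `T - w` is bounded below by
`‖w - z‖` for `w` near `z`: with equality in norm on the eigenspace, and through the gap on its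
orthogonal complement. Hence nearby `w ≠ z` are regular and `z` is isolated. -/
theorem notMem_essentialSpectrum_of_hasSpectralGap [CompleteSpace E] {z : ℂ}
    (hz : HasSpectralGap T z) : z ∉ essentialSpectrum T := by
  rintro ⟨hspec, hiso⟩
  have him : z.im = 0 := by
    by_contra h
    exact hspec (hT.isRegularPoint_of_im_ne_zero h)
  have hconj : starRingEnd ℂ z = z := Complex.conj_eq_iff_im.2 him
  obtain ⟨hfin, C, hC⟩ := hz
  by_cases hbot : eigenspace T z = ⊥
  · refine hspec (hT.isRegularPoint_of_bounded_below (c := (max C 1)⁻¹) (by positivity)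
      (fun f => ?_) (by rw [hconj, hbot]))
    obtain ⟨n, hn, hfn⟩ := hC f
    rw [hbot, Submodule.mem_bot] at hn
    rw [hn, sub_zero] at hfn
    rw [inv_mul_le_iff₀ (by positivity)]
    exact hfn.trans (by gcongr; exact le_max_left _ _)
  refine hiso ⟨hbot, hfin, ?_⟩
  -- The factor `2` lets the term `max C 0 * ‖w - z‖ * ‖q‖`, which comes from replacing `z` by `w`,
  -- be absorbed into half of `‖q‖`.
  have key : ∀ w : ℂ, 2 * max C 0 * ‖w - z‖ ≤ 1 → ∀ f : T.domain,
      ‖w - z‖ * ‖(f : E)‖ ≤ ‖T f - w • (f : E)‖ := by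
    intro w hw f
    obtain ⟨n, hn, hfn⟩ := hC f
    set N := eigenspace T z with hN
    set p : E := N.starProjection f with hp
    have hpN : p ∈ N := N.starProjection_apply_mem f
    obtain ⟨hpD, hTp⟩ := id hpN
    set q : T.domain := f - ⟨p, hpD⟩ with hq
    have hqE : (q : E) = f - p := rfl
    have hTq : T q = T f - z • p := by rw [hq, T.map_sub, hTp]
    have hqN : (q : E) ∈ Nᗮ := by rw [hqE]; exact N.sub_starProjection_mem_orthogonal f
    have horth : inner ℂ p (q : E) = 0 := (Submodule.mem_orthogonal _ _).1 hqN p hpN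
    -- The orthogonal projection is the nearest point of the eigenspace, so it may replace the
    -- unspecified `n`.
    have hqn : ‖(q : E)‖ ≤ ‖(f : E) - n‖ := by
      have h1 : (f : E) - n = q + (p - n) := by rw [hqE]; abel
      have h2 : inner ℂ (q : E) (p - n) = 0 :=
        (Submodule.mem_orthogonal' _ _).1 hqN _ (N.sub_mem hpN hn)
      have h3 := norm_add_sq_eq_norm_sq_add_norm_sq_of_inner_eq_zero (q : E) (p - n) h2
      rw [← h1] at h3
      nlinarith [norm_nonneg (q : E), norm_nonneg (p - n), norm_nonneg ((f : E) - n)]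
    have hfq : T f - z • (f : E) = (T q - w • (q : E)) + (w - z) • (q : E) := by
      rw [hTq, hqE, sub_smul]; simp only [smul_sub]; abel
    have hqb : ‖(q : E)‖ ≤ 2 * max C 0 * ‖T q - w • (q : E)‖ := by
      have h1 : ‖(q : E)‖ ≤ max C 0 * (‖T q - w • (q : E)‖ + ‖w - z‖ * ‖(q : E)‖) := by
        refine hqn.trans (hfn.trans ?_)
        rw [hfq]
        refine mul_le_mul (le_max_left _ _) ?_ (norm_nonneg _) (le_max_right _ _)
        exact (norm_add_le _ _).trans (by rw [norm_smul])
      nlinarith [mul_le_mul_of_nonneg_right hw (norm_nonneg (q : E))]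
    have hqb' : ‖w - z‖ * ‖(q : E)‖ ≤ ‖T q - w • (q : E)‖ := by
      calc ‖w - z‖ * ‖(q : E)‖ ≤ ‖w - z‖ * (2 * max C 0 * ‖T q - w • (q : E)‖) := by gcongr
        _ = (2 * max C 0 * ‖w - z‖) * ‖T q - w • (q : E)‖ := by ring
        _ ≤ 1 * ‖T q - w • (q : E)‖ := by gcongr
        _ = _ := one_mul _
    have hsplit : T f - w • (f : E) = (z - w) • p + (T q - w • (q : E)) := by
      rw [hTq, hqE, sub_smul, smul_sub]; abel
    have horth2 : inner ℂ ((z - w) • p) (T q - w • (q : E)) = 0 := by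
      rw [inner_smul_left, inner_sub_right, inner_smul_right, horth]
      have := hT.symm ⟨p, hpD⟩ q
      rw [hTp, inner_smul_left, horth, mul_zero] at this
      simp [← this]
    have h3 := norm_add_sq_eq_norm_sq_add_norm_sq_of_inner_eq_zero _ _ horth2
    rw [← hsplit, norm_smul, norm_sub_rev z w] at h3
    have h4 := norm_add_sq_eq_norm_sq_add_norm_sq_of_inner_eq_zero p (q : E) horth
    rw [hqE, add_sub_cancel, ← hqE] at h4
    refine le_of_sq_le_sq ?_ (norm_nonneg _)
    have h5 := mul_self_le_mul_self (by positivity) hqb'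
    calc (‖w - z‖ * ‖(f : E)‖) ^ 2 = ‖w - z‖ ^ 2 * (‖(f : E)‖ * ‖(f : E)‖) := by ring
      _ ≤ ‖T f - w • (f : E)‖ * ‖T f - w • (f : E)‖ := by rw [h4, h3]; linarith
      _ = _ := by ring
  have hev : ∀ᶠ w in 𝓝[≠] z, 2 * max C 0 * ‖w - z‖ ≤ 1 := by
    have h1 : Tendsto (fun w : ℂ => 2 * max C 0 * ‖w - z‖) (𝓝 z) (𝓝 0) := by
      have : Continuous fun w : ℂ => 2 * max C 0 * ‖w - z‖ := by fun_prop
      simpa using this.tendsto z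
    exact ((h1.eventually_lt_const zero_lt_one).mono fun w hw => hw.le).filter_mono
      nhdsWithin_le_nhds
  filter_upwards [hev, self_mem_nhdsWithin] with w hw hwz
  have hpos : 0 < ‖w - z‖ := norm_pos_iff.2 (sub_ne_zero.2 hwz)
  refine not_not.2 (hT.isRegularPoint_of_bounded_below hpos (key w hw) ?_)
  have hcw : ‖starRingEnd ℂ w - z‖ = ‖w - z‖ := by
    rw [← hconj, ← map_sub, RCLike.norm_conj, hconj]
  exact eigenspace_eq_bot_of_bounded_below (hcw ▸ hpos) (key _ (hcw ▸ hw))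

/-- By Riesz's theorem it is enough that the closed unit ball is compact. Eigenvectors minus their
weak limit form a weakly null sequence annihilated by `T - z`, so weak convergence becomes norm
convergence. -/
theorem finiteDimensional_eigenspace [CompleteSpace E] [TopologicalSpace.SeparableSpace E] {z : ℂ}
    (hz : NoSingularSequence T z) : FiniteDimensional ℂ (eigenspace T z) := by
  refine FiniteDimensional.of_isCompact_closedBall₀ ℂ zero_lt_one ?_
  rw [isCompact_iff_isSeqCompact]
  intro u hu
  have hb : ∀ n, ‖(u n : E)‖ ≤ 1 := fun n => by simpa using hu n
  choose huD huT using fun n => (u n).2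
  obtain ⟨x, φ, hφ, hx⟩ := exists_subseq_weakTendsto hb
  have hxN : x ∈ eigenspace T z :=
    hT.mem_eigenspace_of_weakTendsto (f := fun n => ⟨u (φ n), huD (φ n)⟩) hx (by simp [huT])
  obtain ⟨hxD, hxT⟩ := id hxN
  have hlim := hz (fun n => ⟨u (φ n), huD (φ n)⟩ - ⟨x, hxD⟩)
    ⟨1 + ‖x‖, fun n => (norm_sub_le _ _).trans (by gcongr; exact hb _)⟩
    (by simpa using hx.sub (weakTendsto_of_tendsto (tendsto_const_nhds (x := x))))
    (by simp [T.map_sub, huT, hxT, smul_sub])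
  have hlim' : Tendsto (fun n => (u (φ n) : E)) atTop (𝓝 x) := by
    have := hlim.add_const x
    simpa using this
  have hlim'' : Tendsto (u ∘ φ) atTop (𝓝 ⟨x, hxN⟩) := tendsto_subtype_rng.2 hlim'
  exact ⟨⟨x, hxN⟩, Metric.isClosed_closedBall.mem_of_tendsto hlim''
    (Eventually.of_forall fun n => hu _), φ, hφ, hlim''⟩

/-- If no constant worked, normalizing the components orthogonal to the eigenspace would give unit
vectors with `(T - z) g n → 0`. A weak limit lies both in the eigenspace and in its complement, so
it is zero, which contradicts the unit norms. -/
theorem hasSpectralGap_of_noSingularSequence [CompleteSpace E] [TopologicalSpace.SeparableSpace E]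
    {z : ℂ} (hz : NoSingularSequence T z) : HasSpectralGap T z := by
  have hfin := hT.finiteDimensional_eigenspace hz
  refine ⟨hfin, ?_⟩
  set N := eigenspace T z with hN
  by_contra! hcon
  choose f hf using fun n : ℕ => hcon n
  have hpD : ∀ x : E, N.starProjection x ∈ T.domain := fun x => (N.starProjection_apply_mem x).1
  have hTp : ∀ x : E, T ⟨_, hpD x⟩ = z • N.starProjection x :=
    fun x => (N.starProjection_apply_mem x).2
  set q : ℕ → T.domain := fun n => f n - ⟨_, hpD (f n)⟩ with hq
  have hqE : ∀ n, (q n : E) = f n - N.starProjection (f n : E) := fun n => rfl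
  have hTq : ∀ n, T (q n) - z • (q n : E) = T (f n) - z • (f n : E) := fun n => by
    rw [hqE, hq, T.map_sub, hTp, smul_sub]; abel
  have hlt : ∀ n : ℕ, (n : ℝ) * ‖T (q n) - z • (q n : E)‖ < ‖(q n : E)‖ := fun n => by
    rw [hTq, hqE]; exact hf n _ (N.starProjection_apply_mem _)
  have hpos : ∀ n, 0 < ‖(q n : E)‖ := fun n => lt_of_le_of_lt (by positivity) (hlt n)
  set g : ℕ → T.domain := fun n => ((‖(q n : E)‖⁻¹ : ℝ) : ℂ) • q n with hg
  have hgE : ∀ n, (g n : E) = ((‖(q n : E)‖⁻¹ : ℝ) : ℂ) • (q n : E) := fun n => rfl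
  have hgn : ∀ n, ‖(g n : E)‖ = 1 := fun n => by
    rw [hgE, norm_smul, Complex.norm_real, norm_inv, norm_norm, inv_mul_cancel₀ (hpos n).ne']
  have hgN : ∀ n, (g n : E) ∈ Nᗮ := fun n => by
    rw [hgE, hqE]; exact Nᗮ.smul_mem _ (N.sub_starProjection_mem_orthogonal _)
  have hTg : Tendsto (fun n => T (g n) - z • (g n : E)) atTop (𝓝 0) := by
    refine squeeze_zero_norm' ?_ (tendsto_inv_atTop_nhds_zero_nat (𝕜 := ℝ))
    filter_upwards [eventually_gt_atTop 0] with n hn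
    have hn' : (0 : ℝ) < n := Nat.cast_pos.2 hn
    have h1 : T (g n) - z • (g n : E) = ((‖(q n : E)‖⁻¹ : ℝ) : ℂ) • (T (q n) - z • (q n : E)) := by
      rw [hgE, hg, T.map_smul, smul_sub, smul_comm z]
    rw [h1, norm_smul, Complex.norm_real, norm_inv, norm_norm, inv_mul_le_iff₀ (hpos n),
      le_mul_inv_iff₀ hn', mul_comm]
    exact (hlt n).le
  obtain ⟨x, φ, hφ, hx⟩ := exists_subseq_weakTendsto (fun n => (hgn n).le)
  have hTgφ := hTg.comp hφ.tendsto_atTop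
  have hxN : x ∈ N := hT.mem_eigenspace_of_weakTendsto (f := fun n => g (φ n)) hx hTgφ
  have hx0 : x = 0 := by
    have h1 := hx.inner x
    have h2 : ∀ n, inner ℂ x (g (φ n) : E) = 0 := fun n =>
      (Submodule.mem_orthogonal _ _).1 (hgN _) x hxN
    simp only [h2] at h1
    exact inner_self_eq_zero.1 (tendsto_nhds_unique h1 tendsto_const_nhds)
  rw [hx0] at hx
  have hlim := (hz (fun n => g (φ n)) ⟨1, fun n => (hgn _).le⟩ hx hTgφ).norm
  simp only [hgn, norm_zero] at hlim
  exact one_ne_zero (tendsto_nhds_unique tendsto_const_nhds hlim)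

/-- Weyl's criterion: the points outside the essential spectrum are those without a singular
sequence. -/
theorem notMem_essentialSpectrum_iff [CompleteSpace E] [TopologicalSpace.SeparableSpace E] {z : ℂ} :
    z ∉ essentialSpectrum T ↔ NoSingularSequence T z :=
  ⟨fun h => (hT.hasSpectralGap_of_notMem_essentialSpectrum h).noSingularSequence,
    fun h => hT.notMem_essentialSpectrum_of_hasSpectralGap
      (hT.hasSpectralGap_of_noSingularSequence h)⟩

end IsSelfAdjointOp

end SelfAdjoint

/-! ### Bounded multiplication operators and self-adjointness -/

/-- Self-adjointness of `T = J⁻¹ m⁻¹ P J` with respect to the scalar product `(J f, m J g)`. -/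
theorem IsSelfAdjointOp.of_weighted {E F : Type*} [NormedAddCommGroup E] [InnerProductSpace ℂ E]
    [NormedAddCommGroup F] [InnerProductSpace ℂ F] {P : E →ₗ.[ℂ] E} {T : F →ₗ.[ℂ] F}
    (hP : IsSelfAdjointOp P) (J : F ≃ₗ[ℂ] E) {m : E → E} (hm : Function.Injective m)
    (hsymm : ∀ x y, inner ℂ (m x) y = inner ℂ x (m y))
    (hinner : ∀ f g : F, inner ℂ f g = inner ℂ (J f) (m (J g)))
    (hdom : ∀ f, f ∈ T.domain ↔ J f ∈ P.domain)
    (hT : ∀ (f : T.domain) (h : J f ∈ P.domain), m (J (T f)) = P ⟨J f, h⟩) :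
    IsSelfAdjointOp T := by
  refine ⟨fun f g => ?_, fun g h hgh => ?_⟩
  · rw [hinner, hinner, hT g ((hdom _).1 g.2), ← hsymm, hT f ((hdom _).1 f.2)]
    exact hP.symm ⟨J f, _⟩ ⟨J g, _⟩
  · obtain ⟨hD, hD'⟩ := hP.mem_of_adjoint (J g) (m (J h)) fun f => by
      have hf : J (J.symm f) ∈ P.domain := by rw [J.apply_symm_apply]; exact f.2
      have h1 := hgh ⟨J.symm f, (hdom _).2 hf⟩
      rw [hinner, hinner, ← hsymm, hT _ hf] at h1
      simpa using h1
    refine ⟨(hdom _).2 hD, J.injective (hm ?_)⟩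
    rw [hT _ hD, hD']

section Multiplication

variable {d k : ℕ}

theorem continuous_act : Continuous fun B : Matrix (Fin k) (Fin k) ℂ => act B :=
  ((Matrix.toEuclideanCLM (n := Fin k) (𝕜 := ℂ)).toAlgEquiv.toLinearMap)
    |>.continuous_of_finiteDimensional

theorem aemeasurable_norm_act {B : Sp d → Matrix (Fin k) (Fin k) ℂ}
    (hB : ∀ i j, AEMeasurable (fun x => B x i j) volume) :
    AEMeasurable (fun x => ‖act (B x)‖) volume := by
  have h1 : AEMeasurable (fun x => (fun i j => B x i j : Fin k → Fin k → ℂ)) volume :=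
    aemeasurable_pi_lambda _ fun i => aemeasurable_pi_lambda _ fun j => hB i j
  have hof : Continuous fun B : Fin k → Fin k → ℂ => (Matrix.of B) := continuous_id
  exact (continuous_act.comp hof).norm.measurable.comp_aemeasurable h1

/-- Multiplication by a bounded matrix-function is a bounded operator. -/
theorem exists_mulCLM {B : Sp d → Matrix (Fin k) (Fin k) ℂ}
    (hB : ∀ i j, AEMeasurable (fun x => B x i j) volume) {C : ℝ}
    (hC : ∀ x v, ‖act (B x) v‖ ≤ C * ‖v‖) :
    ∃ L : L2 d k →L[ℂ] L2 d k, ∀ f : L2 d k, L f =ᵐ[volume] fun x => act (B x) (f x) := by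
  let L₀ : L2 d k →ₗ[ℂ] L2 d k := (mulOp B).toFun ∘ₗ
    LinearMap.codRestrict (mulDomain B) LinearMap.id fun f => memLp_act hB hC f
  have hL₀ : ∀ f : L2 d k, L₀ f =ᵐ[volume] fun x => act (B x) (f x) := fun f => coeFn_mulFun B _
  refine ⟨L₀.mkContinuous C fun f => ?_, hL₀⟩
  refine Lp.norm_le_mul_norm_of_ae_le_mul ?_
  filter_upwards [hL₀ f] with x hx
  rw [hx]
  exact hC x _

theorem inner_eq_of_ae_eq_act {B : Sp d → Matrix (Fin k) (Fin k) ℂ} (hB : ∀ x, (B x).IsHermitian)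
    {f g F G : L2 d k} (hF : F =ᵐ[volume] fun x => act (B x) (f x))
    (hG : G =ᵐ[volume] fun x => act (B x) (g x)) : inner ℂ F g = inner ℂ f G := by
  rw [L2.inner_def, L2.inner_def]
  refine integral_congr_ae ?_
  filter_upwards [hF, hG] with x h1 h2
  rw [h1, h2, inner_act_symm (hB x)]

theorem act_smul (c : ℂ) (B : Matrix (Fin k) (Fin k) ℂ) (v : EuclideanSpace ℂ (Fin k)) :
    act (c • B) v = c • act B v := by
  simp [act]

theorem act_one (v : EuclideanSpace ℂ (Fin k)) :
    act (1 : Matrix (Fin k) (Fin k) ℂ) v = v := by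
  simp [act]

theorem isHermitian_ofReal_smul {B : Matrix (Fin k) (Fin k) ℂ} (hB : B.IsHermitian) (r : ℝ) :
    ((r : ℂ) • B).IsHermitian := by
  rw [Matrix.IsHermitian, Matrix.conjTranspose_smul, hB.eq]
  simp

theorem coeFn_mulOp (B : Sp d → Matrix (Fin k) (Fin k) ℂ) (f : (mulOp B).domain) :
    mulOp B f =ᵐ[volume] fun x => act (B x) ((f : L2 d k) x) :=
  coeFn_mulFun B f

theorem mem_mulOp_domain_of_ae_eq {B : Sp d → Matrix (Fin k) (Fin k) ℂ} {f F : L2 d k}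
    (hF : F =ᵐ[volume] fun x => act (B x) (f x)) : f ∈ (mulOp B).domain :=
  mem_mulDomain.2 ((Lp.memLp F).ae_eq hF)

theorem mulOp_symm {B : Sp d → Matrix (Fin k) (Fin k) ℂ} (hH : ∀ x, (B x).IsHermitian)
    (f g : (mulOp B).domain) :
    inner ℂ (mulOp B f) (g : L2 d k) = inner ℂ (f : L2 d k) (mulOp B g) :=
  inner_eq_of_ae_eq_act hH (coeFn_mulOp B f) (coeFn_mulOp B g)

/-- A positive weight which makes multiplication by `B` bounded. -/
theorem exists_damping {B : Sp d → Matrix (Fin k) (Fin k) ℂ}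
    (hB : ∀ i j, AEMeasurable (fun x => B x i j) volume) :
    ∃ φ : Sp d → ℝ, AEMeasurable (fun x => (φ x : ℂ)) volume ∧ (∀ x, 0 < φ x) ∧ (∀ x, φ x ≤ 1) ∧
      ∀ x, φ x * ‖act (B x)‖ ≤ 1 := by
  have h0 := aemeasurable_norm_act hB
  have hn : ∀ x, 0 ≤ ‖act (B x)‖ := fun x => norm_nonneg _
  refine ⟨fun x => (1 + ‖act (B x)‖)⁻¹, ?_, fun x => ?_, fun x => ?_, fun x => ?_⟩
  · exact Complex.measurable_ofReal.comp_aemeasurable (h0.const_add 1).inv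
  · exact inv_pos.2 (by linarith [hn x])
  · exact inv_le_one_of_one_le₀ (by linarith [hn x])
  · rw [inv_mul_le_iff₀ (by linarith [hn x])]; linarith [hn x]

/-- For the adjoint, test with vectors `φ u`, where the positive weight `φ` makes `φ B` bounded, so
that they lie in the domain. This gives `φ B g = φ h`, and `φ` cancels pointwise. -/
theorem isSelfAdjointOp_mulOp {B : Sp d → Matrix (Fin k) (Fin k) ℂ}
    (hB : ∀ i j, AEMeasurable (fun x => B x i j) volume) (hH : ∀ x, (B x).IsHermitian) :
    IsSelfAdjointOp (mulOp B) := by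
  refine ⟨fun f g => mulOp_symm hH f g, ?_⟩
  intro g h hgh
  obtain ⟨φ, hφm, hφ0, hφ2, hφ1⟩ := exists_damping hB
  obtain ⟨S, hS⟩ := exists_mulCLM (B := fun x => (φ x : ℂ) • B x) (C := 1)
    (fun i j => hφm.mul (hB i j)) (fun x v => by
      rw [act_smul, norm_smul, Complex.norm_real, Real.norm_of_nonneg (hφ0 x).le]
      calc φ x * ‖act (B x) v‖ ≤ φ x * (‖act (B x)‖ * ‖v‖) := by
            gcongr
            · exact (hφ0 x).le
            · exact (act (B x)).le_opNorm v
        _ = φ x * ‖act (B x)‖ * ‖v‖ := by ring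
        _ ≤ 1 * ‖v‖ := by gcongr; exact hφ1 x)
  obtain ⟨J, hJ⟩ := exists_mulCLM (d := d) (k := k)
    (B := fun x => (φ x : ℂ) • (1 : Matrix (Fin k) (Fin k) ℂ)) (C := 1)
    (fun i j => hφm.mul_const _) (fun x v => by
      rw [act_smul, norm_smul, Complex.norm_real, Real.norm_of_nonneg (hφ0 x).le, act_one]
      gcongr; exact hφ2 x)
  have hSJ : ∀ u : L2 d k, S u =ᵐ[volume] fun x => act (B x) (J u x) := fun u => by
    filter_upwards [hS u, hJ u] with x h1 h2
    rw [h1, h2, act_smul, act_smul, act_one, map_smul]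
  have hSs : ∀ u v, inner ℂ (S u) v = inner ℂ u (S v) := fun u v =>
    inner_eq_of_ae_eq_act (B := fun x => (φ x : ℂ) • B x)
      (fun x => isHermitian_ofReal_smul (hH x) (φ x)) (hS u) (hS v)
  have hJs : ∀ u v, inner ℂ (J u) v = inner ℂ u (J v) := fun u v =>
    inner_eq_of_ae_eq_act (B := fun x => (φ x : ℂ) • 1)
      (fun x => isHermitian_ofReal_smul Matrix.isHermitian_one (φ x)) (hJ u) (hJ v)
  have key : S g = J h := by
    refine ext_inner_left ℂ fun u => ?_
    have hD : J u ∈ (mulOp B).domain := mem_mulOp_domain_of_ae_eq (hSJ u)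
    have h1 : mulOp B ⟨J u, hD⟩ = S u := Lp.ext ((coeFn_mulOp B ⟨J u, hD⟩).trans (hSJ u).symm)
    have h2 := hgh ⟨J u, hD⟩
    rw [h1] at h2
    exact (hSs u g).symm.trans (h2.trans (hJs u h))
  have hae : h =ᵐ[volume] fun x => act (B x) (g x) := by
    have h3 := hJ h
    rw [← key] at h3
    filter_upwards [hS g, h3] with x h1 h2
    rw [h1, act_smul, act_smul, act_one] at h2
    exact (smul_right_injective _ (Complex.ofReal_ne_zero.2 (hφ0 x).ne') h2).symm
  exact ⟨mem_mulOp_domain_of_ae_eq hae, Lp.ext ((coeFn_mulOp B _).trans hae.symm)⟩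

theorem aemeasurable_comp_smul {f : Sp d → ℂ} (hf : AEMeasurable f volume) {r : ℝ} (hr : r ≠ 0) :
    AEMeasurable (fun ξ => f (r • ξ)) volume := by
  refine hf.comp_quasiMeasurePreserving ⟨measurable_const_smul r, ?_⟩
  rw [Measure.map_addHaar_smul _ hr]
  exact Measure.smul_absolutelyContinuous

/-- The `L₂` Fourier transform. -/
abbrev fourierL2 (d k : ℕ) : L2 d k ≃ₗᵢ[ℂ] L2 d k :=
  Lp.fourierTransformₗᵢ (Sp d) (EuclideanSpace ℂ (Fin k))

theorem fourierL2_pseudoDiffOp (A : Sp d → Matrix (Fin k) (Fin k) ℂ)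
    (f : (pseudoDiffOp A).domain) :
    fourierL2 d k (pseudoDiffOp A f) =
      mulOp (fun ξ => A ((2 * Real.pi) • ξ)) ⟨fourierL2 d k f, f.2⟩ :=
  (fourierL2 d k).apply_symm_apply _

theorem isSelfAdjointOp_pseudoDiffOp {A : Sp d → Matrix (Fin k) (Fin k) ℂ}
    (hA : ∀ i j, AEMeasurable (fun ξ => A ξ i j) volume) (hH : ∀ ξ, (A ξ).IsHermitian) :
    IsSelfAdjointOp (pseudoDiffOp A) := by
  have hpi : 2 * Real.pi ≠ 0 := by positivity
  have hm := isSelfAdjointOp_mulOp (B := fun ξ => A ((2 * Real.pi) • ξ))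
    (fun i j => aemeasurable_comp_smul (hA i j) hpi) (fun ξ => hH _)
  exact hm.of_weighted (fourierL2 d k).toLinearEquiv Function.injective_id (fun _ _ => rfl)
    (fun f g => ((fourierL2 d k).inner_map_map f g).symm) (fun _ => Iff.rfl)
    fun f _ => fourierL2_pseudoDiffOp A f

end Multiplication

/-! ### The weighted space -/

section Weighted

variable {d k : ℕ} (M : Medium d k)

/-- Multiplication by `M(x)`. -/
def Medium.mulMat : L2 d k →L[ℂ] L2 d k :=
  (exists_mulCLM M.aemeasurable M.exists_norm_act_le.choose_spec).choose

namespace Medium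

theorem coeFn_mulMat (f : L2 d k) : M.mulMat f =ᵐ[volume] fun x => act (M.mat x) (f x) :=
  (exists_mulCLM M.aemeasurable M.exists_norm_act_le.choose_spec).choose_spec f

theorem coeFn_mulInv (f : L2 d k) : M.mulInv f =ᵐ[volume] fun x => act (M.mat x)⁻¹ (f x) :=
  coeFn_mulFun _ _

theorem inner_mulMat (f g : L2 d k) : inner ℂ (M.mulMat f) g = inner ℂ f (M.mulMat g) :=
  inner_eq_of_ae_eq_act M.isHermitian (M.coeFn_mulMat f) (M.coeFn_mulMat g)

theorem mulMat_mulInv (f : L2 d k) : M.mulMat (M.mulInv f) = f := by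
  refine Lp.ext ?_
  filter_upwards [M.coeFn_mulMat (M.mulInv f), M.coeFn_mulInv f] with x h1 h2
  rw [h1, h2, ← mul_apply_eq_comp, act, act, ← map_mul,
    Matrix.mul_nonsing_inv _ (M.isUnit_det x), map_one, one_apply_eq_self]

theorem mulInv_mulMat (f : L2 d k) : M.mulInv (M.mulMat f) = f := by
  refine Lp.ext ?_
  filter_upwards [M.coeFn_mulInv (M.mulMat f), M.coeFn_mulMat f] with x h1 h2
  rw [h1, h2, ← mul_apply_eq_comp, act, act, ← map_mul,
    Matrix.nonsing_inv_mul _ (M.isUnit_det x), map_one, one_apply_eq_self]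

end Medium

namespace WeightedL2

theorem inner_eq (f g : WeightedL2 M) :
    inner ℂ f g = inner ℂ (toL2 M f) (M.mulMat (toL2 M g)) := by
  change weightedInner M (toL2 M f) (toL2 M g) = _
  rw [weightedInner, L2.inner_def]
  refine integral_congr_ae ?_
  filter_upwards [M.coeFn_mulMat (toL2 M g)] with x hx
  rw [hx]

theorem norm_sq_eq (f : WeightedL2 M) :
    ‖f‖ ^ 2 = RCLike.re (inner ℂ (toL2 M f) (M.mulMat (toL2 M f))) := by
  rw [← inner_eq, inner_self_eq_norm_sq]

theorem exists_norm_le : ∃ C : ℝ, 0 ≤ C ∧ ∀ f : WeightedL2 M, ‖f‖ ≤ C * ‖toL2 M f‖ := by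
  refine ⟨Real.sqrt ‖M.mulMat‖, Real.sqrt_nonneg _, fun f => ?_⟩
  refine le_of_sq_le_sq ?_ (by positivity)
  rw [norm_sq_eq, mul_pow, Real.sq_sqrt (norm_nonneg _)]
  refine (RCLike.re_le_norm _).trans ((norm_inner_le_norm _ _).trans ?_)
  have := M.mulMat.le_opNorm (toL2 M f)
  nlinarith [norm_nonneg (toL2 M f)]

theorem exists_norm_toL2_le : ∃ C : ℝ, 0 ≤ C ∧ ∀ f : WeightedL2 M, ‖toL2 M f‖ ≤ C * ‖f‖ := by
  obtain ⟨c₀, c₁, hc₀, h⟩ := M.bounds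
  have key : ∀ f : WeightedL2 M, c₀ * ‖toL2 M f‖ ^ 2 ≤ ‖f‖ ^ 2 := fun f => by
    have h0 : ‖f‖ ^ 2 = RCLike.re (weightedInner M (toL2 M f) (toL2 M f)) := by
      rw [← inner_self_eq_norm_sq (𝕜 := ℂ) f]; rfl
    rw [h0, re_weightedInner_self, ← inner_self_eq_norm_sq (𝕜 := ℂ) (toL2 M f), L2.inner_def,
      ← integral_re (L2.integrable_inner _ _), ← integral_const_mul]
    refine integral_mono ((L2.integrable_inner _ _).re.const_mul _)
      (integrable_weightedInner M _ _).re fun x => ?_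
    simp only
    rw [inner_self_eq_norm_sq]
    exact inner_act_ge (h x).1 _
  refine ⟨(Real.sqrt c₀)⁻¹, by positivity, fun f => ?_⟩
  rw [inv_mul_eq_div, le_div_iff₀ (Real.sqrt_pos.2 hc₀)]
  refine le_of_sq_le_sq ?_ (by positivity)
  rw [mul_pow, Real.sq_sqrt hc₀.le, mul_comm]
  exact key f

/-- The identical mapping of `𝓗` onto `L₂(ℝᵈ; ℂᵏ)` is a homeomorphism. -/
def toL2CLE : WeightedL2 M ≃L[ℂ] L2 d k where
  toLinearEquiv := toL2 M
  continuous_toFun :=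
    ((toL2 M).toLinearMap.mkContinuous _ (exists_norm_toL2_le M).choose_spec.2).continuous
  continuous_invFun :=
    ((toL2 M).symm.toLinearMap.mkContinuous _ fun f => by
      simpa using (exists_norm_le M).choose_spec.2 ((toL2 M).symm f)).continuous

instance : CompleteSpace (WeightedL2 M) :=
  (completeSpace_congr (e := (toL2CLE M).toEquiv) (toL2CLE M).isUniformEmbedding).2 inferInstance

instance : TopologicalSpace.SeparableSpace (WeightedL2 M) := by
  have : Fact ((2 : ℝ≥0∞) ≠ ∞) := ⟨by simp⟩
  have : SecondCountableTopology (L2 d k) := inferInstance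
  exact (toL2CLE M).symm.surjective.denseRange.separableSpace (toL2CLE M).symm.continuous

end WeightedL2

variable {M}

theorem mulMat_toL2_mediumOp {A : Sp d → Matrix (Fin k) (Fin k) ℂ} (f : (mediumOp M A).domain) :
    M.mulMat (WeightedL2.toL2 M (mediumOp M A f)) =
      pseudoDiffOp A ⟨WeightedL2.toL2 M f, f.2⟩ :=
  M.mulMat_mulInv _

theorem isSelfAdjointOp_mediumOp {A : Sp d → Matrix (Fin k) (Fin k) ℂ}
    (hA : ∀ i j, AEMeasurable (fun ξ => A ξ i j) volume) (hH : ∀ ξ, (A ξ).IsHermitian) :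
    IsSelfAdjointOp (mediumOp M A) := by
  exact (isSelfAdjointOp_pseudoDiffOp hA hH).of_weighted (WeightedL2.toL2 M)
    (Function.LeftInverse.injective M.mulInv_mulMat) M.inner_mulMat (WeightedL2.inner_eq M)
    (fun _ => Iff.rfl) fun f _ => mulMat_toL2_mediumOp f

end Weighted

/-! ### Local compactness -/

section Compactness

variable {d k : ℕ}

/-- On `L₁ ∩ L₂` the abstract transform and the integral have the same pairing with every test
function: one by duality for tempered distributions, the other by Fubini. -/
theorem fourierL2_symm_ae_eq (v : L2 d k) (hv : Integrable v volume) :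
    (fourierL2 d k).symm v =ᵐ[volume] 𝓕⁻ (v : Sp d → EuclideanSpace ℂ (Fin k)) := by
  have hcont : Continuous (𝓕⁻ (v : Sp d → EuclideanSpace ℂ (Fin k))) :=
    VectorFourier.fourierIntegral_continuous Real.continuous_fourierChar
      (L := -innerₗ (Sp d)) (by exact continuous_inner.neg) hv
  refine ae_eq_of_integral_contDiff_smul_eq
    ((Lp.memLp _).locallyIntegrable (by norm_num)) hcont.locallyIntegrable fun g hg hgc => ?_
  have hg₁ : HasCompactSupport (Complex.ofRealCLM ∘ g) := hgc.comp_left rfl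
  have hg₂ : ContDiff ℝ (⊤ : ℕ∞) (Complex.ofRealCLM ∘ g) := by fun_prop
  set φ := hg₁.toSchwartzMap hg₂ with hφ
  have hφa : ∀ x, φ x = (g x : ℂ) := fun x => rfl
  have h1 : ∫ x, g x • ((fourierL2 d k).symm v) x =
      Lp.toTemperedDistribution ((fourierL2 d k).symm v) φ := by
    rw [Lp.toTemperedDistribution_apply]
    rfl
  have h2 : Lp.toTemperedDistribution ((fourierL2 d k).symm v) φ = ∫ ξ, (𝓕⁻ φ) ξ • v ξ := by
    have := Lp.fourierInv_toTemperedDistribution_eq v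
    have h3 := congrArg (fun D => D φ) this
    simp only [TemperedDistribution.fourierInv_apply, Lp.toTemperedDistribution_apply] at h3
    rw [Lp.toTemperedDistribution_apply]
    exact h3.symm
  have hflip : (-innerₗ (Sp d)).flip = -innerₗ (Sp d) := by
    ext x y
    simp [real_inner_comm]
  have h4 := VectorFourier.integral_fourierIntegral_smul_eq_flip (μ := volume) (ν := volume)
    (L := -innerₗ (Sp d)) Real.continuous_fourierChar (by exact continuous_inner.neg)
    (φ.integrable) hv
  rw [hflip] at h4
  rw [h1, h2, SchwartzMap.fourierInv_coe]
  exact h4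

/-- Restriction of a function to a set, as an operator. -/
theorem exists_cutoff {s : Set (Sp d)} (hs : MeasurableSet s) :
    ∃ Q : L2 d k →L[ℂ] L2 d k, ∀ f : L2 d k, Q f =ᵐ[volume] s.indicator f := by
  obtain ⟨Q, hQ⟩ := exists_mulCLM (d := d) (k := k) (C := 1)
    (B := fun x => s.indicator (fun _ => (1 : ℂ)) x • (1 : Matrix (Fin k) (Fin k) ℂ))
    (fun i j => ((measurable_const.indicator hs).mul_const _).aemeasurable) (fun x v => by
      rw [act_smul, act_one]
      by_cases hx : x ∈ s <;> simp [hx])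
  refine ⟨Q, fun f => ?_⟩
  filter_upwards [hQ f] with x hx
  rw [hx, act_smul, act_one]
  by_cases h : x ∈ s <;> simp [h]

theorem norm_sq_eq_integral (f : L2 d k) : ‖f‖ ^ 2 = ∫ x, ‖f x‖ ^ 2 := by
  rw [← inner_self_eq_norm_sq (𝕜 := ℂ) f, L2.inner_def, ← integral_re (L2.integrable_inner _ _)]
  refine integral_congr_ae (Eventually.of_forall fun x => ?_)
  exact inner_self_eq_norm_sq _

theorem lintegral_enorm_le (u : L2 d k) (s : Set (Sp d)) :
    ∫⁻ ξ in s, ‖u ξ‖ₑ ≤ ENNReal.ofReal ‖u‖ * volume s ^ (1 / 2 : ℝ) := by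
  have h1 := eLpNorm_le_eLpNorm_mul_rpow_measure_univ (μ := volume.restrict s)
    (p := 1) (q := 2) (by norm_num) ((Lp.aestronglyMeasurable u).restrict (s := s))
  rw [eLpNorm_one_eq_lintegral_enorm] at h1
  refine h1.trans ?_
  rw [Lp.norm_def, ENNReal.ofReal_toReal (Lp.eLpNorm_ne_top u), Measure.restrict_apply_univ]
  have h2 : (1 / ENNReal.toReal 1 - 1 / ENNReal.toReal 2 : ℝ) = 1 / 2 := by norm_num
  rw [h2]
  gcongr
  exact Measure.restrict_le_self

theorem integrableOn_of_volume_lt_top (u : L2 d k) {s : Set (Sp d)} (hs : volume s < ∞) :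
    IntegrableOn u s volume := by
  refine ⟨(Lp.aestronglyMeasurable u).restrict, (lintegral_enorm_le u s).trans_lt ?_⟩
  exact ENNReal.mul_lt_top ENNReal.ofReal_lt_top (ENNReal.rpow_lt_top_of_nonneg (by norm_num) hs.ne)

theorem norm_setIntegral_char_le (u : L2 d k) {s : Set (Sp d)} (hs : volume s < ∞) (x : Sp d) :
    ‖∫ ξ in s, Real.fourierChar (inner ℝ ξ x) • u ξ‖ ≤
      (volume s ^ (1 / 2 : ℝ)).toReal * ‖u‖ := by
  have h1 : ‖∫ ξ in s, Real.fourierChar (inner ℝ ξ x) • u ξ‖ₑ ≤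
      ENNReal.ofReal ‖u‖ * volume s ^ (1 / 2 : ℝ) := by
    refine (enorm_integral_le_lintegral_enorm _).trans (le_trans (le_of_eq ?_)
      (lintegral_enorm_le u s))
    refine lintegral_congr fun ξ => ?_
    rw [← ofReal_norm, Circle.norm_smul, ofReal_norm]
  have h2 := ENNReal.toReal_mono (ENNReal.mul_lt_top ENNReal.ofReal_lt_top
    (ENNReal.rpow_lt_top_of_nonneg (by norm_num) hs.ne)).ne h1
  rwa [toReal_enorm, ENNReal.toReal_mul, ENNReal.toReal_ofReal (norm_nonneg _), mul_comm] at h2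

/-- The inverse Fourier integral over a set of finite measure, evaluated at a point, is a bounded
linear mapping. -/
theorem exists_fourierInv_eval {s : Set (Sp d)} (hs : volume s < ∞) (x : Sp d) :
    ∃ L : L2 d k →L[ℂ] EuclideanSpace ℂ (Fin k),
      ∀ u, L u = ∫ ξ in s, Real.fourierChar (inner ℝ ξ x) • u ξ := by
  have hint : ∀ u : L2 d k,
      Integrable (fun ξ => Real.fourierChar (inner ℝ ξ x) • u ξ) (volume.restrict s) := fun u => by
    have hc : Continuous fun ξ : Sp d => Real.fourierChar (inner ℝ ξ x) :=
      Real.continuous_fourierChar.comp (continuous_id.inner continuous_const)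
    refine (integrableOn_of_volume_lt_top u hs).integrable.norm.mono'
      (hc.aestronglyMeasurable.fun_smul (Lp.aestronglyMeasurable u).restrict)
      (Eventually.of_forall fun ξ => (Circle.norm_smul _ _).le)
  let L₀ : L2 d k →ₗ[ℂ] EuclideanSpace ℂ (Fin k) :=
    { toFun := fun u => ∫ ξ in s, Real.fourierChar (inner ℝ ξ x) • u ξ
      map_add' := fun u v => by
        rw [← integral_add (hint u) (hint v)]
        refine integral_congr_ae ?_
        filter_upwards [ae_restrict_of_ae (Lp.coeFn_add u v)] with ξ h
        rw [h, Pi.add_apply, smul_add]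
      map_smul' := fun c u => by
        rw [RingHom.id_apply, ← integral_smul]
        refine integral_congr_ae ?_
        filter_upwards [ae_restrict_of_ae (Lp.coeFn_smul c u)] with ξ h
        rw [h, Pi.smul_apply, smul_comm] }
  exact ⟨L₀.mkContinuous _ fun u => norm_setIntegral_char_le u hs x, fun u => rfl⟩

theorem WeakTendsto.map {E F : Type*} [NormedAddCommGroup E] [NormedSpace ℂ E]
    [NormedAddCommGroup F] [NormedSpace ℂ F] {f : ℕ → E} {x : E} (h : WeakTendsto f x)
    (L : E →L[ℂ] F) : WeakTendsto (fun n => L (f n)) (L x) := fun φ => h (φ ∘L L)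

theorem WeakTendsto.tendsto_euclidean {f : ℕ → EuclideanSpace ℂ (Fin k)}
    {x : EuclideanSpace ℂ (Fin k)} (h : WeakTendsto f x) : Tendsto f atTop (𝓝 x) := by
  have h1 : Tendsto (fun n => EuclideanSpace.equiv (Fin k) ℂ (f n)) atTop
      (𝓝 (EuclideanSpace.equiv (Fin k) ℂ x)) :=
    tendsto_pi_nhds.2 fun i => h (EuclideanSpace.proj i)
  exact ((EuclideanSpace.equiv (Fin k) ℂ).toHomeomorph.isInducing.tendsto_nhds_iff).2 h1

/-- Space and frequency localizations of a bounded weakly null sequence tend to zero in norm. -/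
theorem tendsto_cutoff_fourier_cutoff {u : ℕ → L2 d k} {C : ℝ} (hu : ∀ n, ‖u n‖ ≤ C)
    (hw : WeakTendsto u 0) {s t : Set (Sp d)} (hs : MeasurableSet s) (hs' : volume s < ∞)
    (ht : MeasurableSet t) (ht' : volume t < ∞) {Q S : L2 d k →L[ℂ] L2 d k}
    (hQ : ∀ f : L2 d k, Q f =ᵐ[volume] t.indicator f)
    (hS : ∀ f : L2 d k, S f =ᵐ[volume] s.indicator f) :
    Tendsto (fun n => ‖Q ((fourierL2 d k).symm (S (u n)))‖) atTop (𝓝 0) := by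
  -- Point values of the low-frequency part are bounded linear mappings into `ℂᵏ`, so weak
  -- convergence gives convergence at every point; dominated convergence on `t` then applies.
  choose L hL using exists_fourierInv_eval (d := d) (k := k) hs'
  have hSint : ∀ v : L2 d k, Integrable (S v) volume := fun v =>
    ((integrableOn_of_volume_lt_top v hs').integrable_indicator hs).congr (hS v).symm
  have hFS : ∀ v : L2 d k, (fourierL2 d k).symm (S v) =ᵐ[volume] fun x => L x v := fun v => by
    filter_upwards [fourierL2_symm_ae_eq (S v) (hSint v)] with x hx
    rw [hx, hL, Real.fourierInv_eq, ← integral_indicator hs]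
    refine integral_congr_ae ?_
    filter_upwards [hS v] with ξ hξ
    rw [hξ]
    by_cases h : ξ ∈ s <;> simp [h]
  have hLb : ∀ x v, ‖L x v‖ ≤ (volume s ^ (1 / 2 : ℝ)).toReal * ‖v‖ := fun x v => by
    rw [hL]; exact norm_setIntegral_char_le v hs' x
  have hsq : ∀ n, ‖Q ((fourierL2 d k).symm (S (u n)))‖ ^ 2 = ∫ x in t, ‖L x (u n)‖ ^ 2 := by
    intro n
    rw [norm_sq_eq_integral, ← integral_indicator ht]
    refine integral_congr_ae ?_
    filter_upwards [hQ ((fourierL2 d k).symm (S (u n))), hFS (u n)] with x h1 h2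
    rw [h1]
    by_cases h : x ∈ t <;> simp [h, h2]
  have hlim : Tendsto (fun n => ∫ x in t, ‖L x (u n)‖ ^ 2) atTop (𝓝 (∫ x in t, (0 : ℝ))) := by
    refine tendsto_integral_of_dominated_convergence
      (fun _ => ((volume s ^ (1 / 2 : ℝ)).toReal * C) ^ 2) (fun n => ?_) ?_ (fun n => ?_) ?_
    · have h1 : AEStronglyMeasurable (fun x => L x (u n)) volume :=
        (Lp.aestronglyMeasurable _).congr (hFS (u n))
      exact (h1.norm.pow 2).restrict
    · have : IsFiniteMeasure (volume.restrict t) := ⟨by simpa using ht'⟩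
      exact integrable_const _
    · refine Eventually.of_forall fun x => ?_
      rw [norm_pow, norm_norm]
      gcongr
      exact (hLb x _).trans (by gcongr; exact hu n)
    · refine Eventually.of_forall fun x => ?_
      have := (hw.map (L x)).tendsto_euclidean.norm.pow 2
      simpa using this
  rw [integral_zero] at hlim
  have h3 := (hlim.congr fun n => (hsq n).symm).sqrt
  simpa using h3

theorem nu_mul_norm_le (A : Sp d → Matrix (Fin k) (Fin k) ℂ) (ξ : Sp d)
    (v : EuclideanSpace ℂ (Fin k)) : nu A ξ * ‖v‖ ≤ ‖act (A ξ) v‖ := by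
  rcases eq_or_ne v 0 with rfl | hv
  · simp
  have hv' : 0 < ‖v‖ := norm_pos_iff.2 hv
  have hmem : ((‖v‖⁻¹ : ℝ) : ℂ) • v ∈ Metric.sphere (0 : EuclideanSpace ℂ (Fin k)) 1 := by
    rw [mem_sphere_zero_iff_norm, norm_smul, Complex.norm_real, norm_inv, norm_norm,
      inv_mul_cancel₀ hv'.ne']
  have h1 : nu A ξ ≤ ‖act (A ξ) (((‖v‖⁻¹ : ℝ) : ℂ) • v)‖ :=
    ciInf_le (f := fun n : Metric.sphere (0 : EuclideanSpace ℂ (Fin k)) 1 => ‖act (A ξ) n‖)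
      ⟨0, by rintro _ ⟨n, rfl⟩; exact norm_nonneg _⟩ ⟨_, hmem⟩
  rw [map_smul, norm_smul, Complex.norm_real, norm_inv, norm_norm, ← div_eq_inv_mul,
    le_div_iff₀ hv'] at h1
  exact h1

theorem StronglyCarleman.exists_radius {A : Sp d → Matrix (Fin k) (Fin k) ℂ}
    (hA : StronglyCarleman A) (K : ℝ) :
    ∃ ρ : ℝ, ∀ ξ : Sp d, ξ ∉ Metric.ball 0 ρ → ∀ v, K * ‖v‖ ≤ ‖act (A ((2 * Real.pi) • ξ)) v‖ := by
  have h1 : ∀ᶠ ξ in cobounded (Sp d), K ≤ nu A ξ := hA.eventually_ge_atTop K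
  obtain ⟨r, -, hr⟩ := (Metric.hasBasis_cobounded_compl_closedBall (0 : Sp d)).eventually_iff.1 h1
  -- Adding `1` yields the strict inequality needed outside the closed ball; the dilation by `2π >
  -- 1` only helps.
  refine ⟨r + 1, fun ξ hξ v => le_trans ?_ (nu_mul_norm_le A _ v)⟩
  gcongr
  refine hr ?_
  rw [Metric.mem_ball, dist_zero_right, not_lt] at hξ
  rw [Set.mem_compl_iff, Metric.mem_closedBall, dist_zero_right, not_le, norm_smul,
    Real.norm_of_nonneg (by positivity)]
  nlinarith [Real.pi_gt_three, norm_nonneg ξ]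

/-- A sequence bounded in the graph norm of `P(D)` and weakly null tends to zero locally. -/
theorem tendsto_cutoff_of_weakTendsto {A : Sp d → Matrix (Fin k) (Fin k) ℂ}
    (hA : StronglyCarleman A) {f : ℕ → (pseudoDiffOp A).domain} {C : ℝ}
    (hf : ∀ n, ‖(f n : L2 d k)‖ ≤ C) (hPf : ∀ n, ‖pseudoDiffOp A (f n)‖ ≤ C)
    (hw : WeakTendsto (fun n => (f n : L2 d k)) 0) {t : Set (Sp d)} (ht : MeasurableSet t)
    (ht' : volume t < ∞) {Q : L2 d k →L[ℂ] L2 d k}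
    (hQ : ∀ f : L2 d k, Q f =ᵐ[volume] t.indicator f) :
    Tendsto (fun n => Q (f n : L2 d k)) atTop (𝓝 0) := by
  have hC : 0 ≤ C := (norm_nonneg _).trans (hf 0)
  rw [Metric.tendsto_atTop]
  intro ε hε
  -- Frequencies with `K * ‖v‖ ≤ ‖A v‖` contribute at most `C / K` to the norm, and `‖Q‖ * C / K ≤ ε
  -- / 2`; the `+ 1` keeps `K` positive.
  set K : ℝ := (‖Q‖ * C + 1) * 2 / ε with hK
  have hK0 : 0 < K := by positivity
  obtain ⟨ρ, hρ⟩ := hA.exists_radius K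
  obtain ⟨S, hS⟩ := exists_cutoff (d := d) (k := k)
    (Metric.isOpen_ball (x := (0 : Sp d)) (ε := ρ)).measurableSet
  set F := fourierL2 d k with hF
  have hw' : WeakTendsto (fun n => F (f n : L2 d k)) 0 := by
    simpa using hw.map (F : L2 d k →L[ℂ] L2 d k)
  have hlim := tendsto_cutoff_fourier_cutoff (u := fun n => F (f n : L2 d k)) (C := C)
    (fun n => by rw [F.norm_map]; exact hf n) hw' Metric.isOpen_ball.measurableSet
    Metric.isBounded_ball.measure_lt_top ht ht' hQ hS
  have hrest : ∀ n, ‖F (f n : L2 d k) - S (F (f n))‖ ≤ K⁻¹ * C := fun n => by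
    have h1 : ‖F (f n : L2 d k) - S (F (f n))‖ ≤ K⁻¹ * ‖F (pseudoDiffOp A (f n))‖ := by
      refine Lp.norm_le_mul_norm_of_ae_le_mul ?_
      have h2 := fourierL2_pseudoDiffOp A (f n)
      have h3 := coeFn_mulOp (fun ξ => A ((2 * Real.pi) • ξ)) ⟨F (f n : L2 d k), (f n).2⟩
      rw [← h2] at h3
      filter_upwards [h3, hS (F (f n)), Lp.coeFn_sub (F (f n : L2 d k)) (S (F (f n)))]
        with ξ e1 e2 e3
      rw [e3, Pi.sub_apply, e2, e1]
      by_cases h : ξ ∈ Metric.ball (0 : Sp d) ρ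
      · rw [Set.indicator_of_mem h, sub_self, norm_zero]; positivity
      · rw [Set.indicator_of_notMem h, sub_zero, inv_mul_eq_div, le_div_iff₀' hK0]
        exact hρ ξ h _
    refine h1.trans ?_
    rw [F.norm_map]
    gcongr
    exact hPf n
  obtain ⟨N, hN⟩ := Metric.tendsto_atTop.1 hlim (ε / 2) (by positivity)
  refine ⟨N, fun n hn => ?_⟩
  have h1 := hN n hn
  rw [dist_zero_right, norm_norm] at h1
  rw [dist_zero_right]
  have h2 : (f n : L2 d k) = F.symm (S (F (f n))) + F.symm (F (f n : L2 d k) - S (F (f n))) := by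
    rw [← map_add, add_sub_cancel, F.symm_apply_apply]
  have h3 : ‖Q (F.symm (F (f n : L2 d k) - S (F (f n))))‖ ≤ ε / 2 := by
    refine (Q.le_opNorm _).trans ?_
    rw [F.symm.norm_map]
    calc ‖Q‖ * ‖F (f n : L2 d k) - S (F (f n))‖ ≤ ‖Q‖ * (K⁻¹ * C) := by gcongr; exact hrest n
      _ = (‖Q‖ * C) / (‖Q‖ * C + 1) * (ε / 2) := by rw [hK]; field_simp
      _ ≤ 1 * (ε / 2) := by
        gcongr
        rw [div_le_one (by positivity)]; linarith
      _ = ε / 2 := one_mul _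
  rw [h2, map_add]
  exact (norm_add_le _ _).trans_lt (by linarith)

/-- The perturbation `M - M₀` is relatively compact with respect to `P(D)`. -/
theorem tendsto_mulMat_sub {A : Sp d → Matrix (Fin k) (Fin k) ℂ}
    (hA : StronglyCarleman A) {M M₀ : Medium d k}
    (hV : Tendsto (fun x => M.mat x - M₀.mat x) (cobounded (Sp d)) (𝓝 0))
    {f : ℕ → (pseudoDiffOp A).domain} {C : ℝ}
    (hf : ∀ n, ‖(f n : L2 d k)‖ ≤ C) (hPf : ∀ n, ‖pseudoDiffOp A (f n)‖ ≤ C)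
    (hw : WeakTendsto (fun n => (f n : L2 d k)) 0) :
    Tendsto (fun n => M.mulMat (f n) - M₀.mulMat (f n)) atTop (𝓝 0) := by
  have hC : 0 ≤ C := (norm_nonneg _).trans (hf 0)
  set V : L2 d k →L[ℂ] L2 d k := M.mulMat - M₀.mulMat with hVdef
  have hVa : ∀ g : L2 d k, V g =ᵐ[volume] fun x => act (M.mat x - M₀.mat x) (g x) := fun g => by
    filter_upwards [M.coeFn_mulMat g, M₀.coeFn_mulMat g, Lp.coeFn_sub (M.mulMat g) (M₀.mulMat g)]
      with x h1 h2 h3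
    change (M.mulMat g - M₀.mulMat g : L2 d k) x = _
    rw [h3, Pi.sub_apply, h1, h2]
    simp only [act, map_sub, sub_apply]
  change Tendsto (fun n => V (f n)) atTop (𝓝 0)
  have hVn : Tendsto (fun x => ‖act (M.mat x - M₀.mat x)‖) (cobounded (Sp d)) (𝓝 0) := by
    have := ((continuous_act (k := k)).norm.tendsto 0).comp hV
    rwa [act, map_zero, norm_zero] at this
  rw [Metric.tendsto_atTop]
  intro ε hε
  -- Chosen so that `δ * C ≤ ε / 2`, with `C + 1` to allow `C = 0`.
  set δ : ℝ := ε / (2 * (C + 1)) with hδ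
  have hδ0 : 0 < δ := by positivity
  obtain ⟨r, -, hr⟩ := (Metric.hasBasis_cobounded_compl_closedBall (0 : Sp d)).eventually_iff.1
    (hVn.eventually_lt_const hδ0)
  obtain ⟨Q, hQ⟩ := exists_cutoff (d := d) (k := k)
    (Metric.isClosed_closedBall (x := (0 : Sp d)) (ε := r)).measurableSet
  have hlim := tendsto_cutoff_of_weakTendsto hA hf hPf hw Metric.isClosed_closedBall.measurableSet
    Metric.isBounded_closedBall.measure_lt_top hQ
  have hlimV : Tendsto (fun n => V (Q (f n : L2 d k))) atTop (𝓝 0) := by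
    have := (V.continuous.tendsto 0).comp hlim
    rwa [map_zero] at this
  have hrest : ∀ n, ‖V ((f n : L2 d k) - Q (f n))‖ ≤ δ * C := fun n => by
    refine le_trans (Lp.norm_le_mul_norm_of_ae_le_mul (g := (f n : L2 d k)) (c := δ) ?_)
      (by gcongr; exact hf n)
    filter_upwards [hVa ((f n : L2 d k) - Q (f n)), hQ (f n),
      Lp.coeFn_sub (f n : L2 d k) (Q (f n))] with x e1 e2 e3
    rw [e1, e3, Pi.sub_apply, e2]
    by_cases h : x ∈ Metric.closedBall (0 : Sp d) r
    · rw [Set.indicator_of_mem h, sub_self, map_zero, norm_zero]; positivity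
    · rw [Set.indicator_of_notMem h, sub_zero]
      exact (act _).le_of_opNorm_le (hr h).le _
  obtain ⟨N, hN⟩ := Metric.tendsto_atTop.1 hlimV (ε / 2) (by positivity)
  refine ⟨N, fun n hn => ?_⟩
  have h1 := hN n hn
  rw [dist_zero_right] at h1 ⊢
  have h2 : V (f n : L2 d k) = V (Q (f n)) + V ((f n : L2 d k) - Q (f n)) := by
    rw [← map_add, add_sub_cancel]
  have h3 : δ * C ≤ ε / 2 := by
    rw [hδ, div_mul_eq_mul_div, div_le_div_iff₀ (by positivity) (by positivity)]
    nlinarith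
  rw [h2]
  exact (norm_add_le _ _).trans_lt (by linarith [hrest n])

end Compactness

/-! ### Invariance of the essential spectrum -/

section Invariance

variable {d k : ℕ}

theorem Medium.tendsto_mulInv (M : Medium d k) {f : ℕ → L2 d k} (hf : Tendsto f atTop (𝓝 0)) :
    Tendsto (fun n => M.mulInv (f n)) atTop (𝓝 0) := by
  obtain ⟨L, hL⟩ := exists_mulCLM M.aemeasurable_inv M.exists_norm_act_inv_le.choose_spec
  have h1 : ∀ g, L g = M.mulInv g := fun g => Lp.ext ((hL g).trans (M.coeFn_mulInv g).symm)
  have h2 := (L.continuous.tendsto 0).comp hf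
  rw [map_zero] at h2
  exact h2.congr fun n => h1 _

/-- A candidate singular sequence for `M`, read in `L₂` and then in the space of `M₀`, is one for
`M₀` because `(M - M₀) f n → 0`. Its convergence to zero is carried back by the homeomorphisms. -/
theorem NoSingularSequence.of_medium {A : Sp d → Matrix (Fin k) (Fin k) ℂ}
    (hA : StronglyCarleman A) {M M₀ : Medium d k}
    (hV : Tendsto (fun x => M.mat x - M₀.mat x) (cobounded (Sp d)) (𝓝 0)) {z : ℂ}
    (h : NoSingularSequence (mediumOp M₀ A) z) : NoSingularSequence (mediumOp M A) z := by
  rintro f ⟨C, hC⟩ hw hlim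
  set g : ℕ → (pseudoDiffOp A).domain := fun n => ⟨WeightedL2.toL2 M (f n), (f n).2⟩ with hg
  have hgw : WeakTendsto (fun n => (g n : L2 d k)) 0 := by
    have := hw.map (WeightedL2.toL2CLE M : WeightedL2 M →L[ℂ] L2 d k)
    rwa [map_zero] at this
  obtain ⟨C₁, hC₁, hC₁'⟩ := WeightedL2.exists_norm_toL2_le M
  have hgb : ∀ n, ‖(g n : L2 d k)‖ ≤ C₁ * C := fun n =>
    (hC₁' _).trans (mul_le_mul_of_nonneg_left (hC n) hC₁)
  have hres : Tendsto (fun n => pseudoDiffOp A (g n) - z • M.mulMat (g n)) atTop (𝓝 0) := by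
    have h1 := ((M.mulMat ∘L (WeightedL2.toL2CLE M : WeightedL2 M →L[ℂ] L2 d k)).continuous.tendsto
      0).comp hlim
    rw [map_zero] at h1
    refine h1.congr fun n => ?_
    change M.mulMat (WeightedL2.toL2 M (mediumOp M A (f n) - z • (f n : WeightedL2 M))) = _
    rw [map_sub, map_sub, map_smul, map_smul, mulMat_toL2_mediumOp]
  obtain ⟨C₂, hC₂⟩ := (hres.norm.bddAbove_range)
  -- The graph-norm bound required for local compactness: a convergent residual plus the bounded
  -- term `z M g n`.
  have hPb : ∀ n, ‖pseudoDiffOp A (g n)‖ ≤ C₂ + ‖z‖ * (‖M.mulMat‖ * (C₁ * C)) := fun n => by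
    have h1 : pseudoDiffOp A (g n) =
        (pseudoDiffOp A (g n) - z • M.mulMat (g n)) + z • M.mulMat (g n) := by abel
    rw [h1]
    refine (norm_add_le _ _).trans (add_le_add (hC₂ ⟨n, rfl⟩) ?_)
    rw [norm_smul]
    gcongr
    exact (M.mulMat.le_opNorm _).trans (by gcongr; exact hgb n)
  have hpert := tendsto_mulMat_sub hA hV
    (fun n => (hgb n).trans (le_max_left _ (C₂ + ‖z‖ * (‖M.mulMat‖ * (C₁ * C)))))
    (fun n => (hPb n).trans (le_max_right _ _)) hgw
  have hres₀ : Tendsto (fun n => pseudoDiffOp A (g n) - z • M₀.mulMat (g n)) atTop (𝓝 0) := by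
    have h1 := hres.add (hpert.const_smul z)
    rw [smul_zero, add_zero] at h1
    refine h1.congr fun n => ?_
    rw [smul_sub]; abel
  let f₀ : ℕ → (mediumOp M₀ A).domain := fun n => ⟨(WeightedL2.toL2 M₀).symm (g n), by
    change WeightedL2.toL2 M₀ ((WeightedL2.toL2 M₀).symm (g n : L2 d k)) ∈ (pseudoDiffOp A).domain
    rw [LinearEquiv.apply_symm_apply]; exact (g n).2⟩
  let J₀ : L2 d k →L[ℂ] WeightedL2 M₀ := (WeightedL2.toL2CLE M₀).symm
  have hf₀ : ∀ n, (f₀ n : WeightedL2 M₀) = J₀ (g n) := fun n => rfl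
  have hlim₀ := h f₀ ⟨‖J₀‖ * (C₁ * C), fun n => by
      rw [hf₀]; exact (J₀.le_opNorm _).trans (by gcongr; exact hgb n)⟩
    (by
      have := hgw.map J₀
      rwa [map_zero] at this)
    (by
      have h1 := (J₀.continuous.tendsto 0).comp (M₀.tendsto_mulInv hres₀)
      rw [map_zero] at h1
      refine h1.congr fun n => ?_
      change J₀ (M₀.mulInv (pseudoDiffOp A (g n) - z • M₀.mulMat (g n))) = _
      rw [map_sub, map_smul, M₀.mulInv_mulMat, map_sub, map_smul]
      rfl)
  have hfin : Tendsto (fun n => (WeightedL2.toL2CLE M).symm (WeightedL2.toL2CLE M₀ (f₀ n)))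
      atTop (𝓝 0) := by
    have := (((WeightedL2.toL2CLE M₀).trans (WeightedL2.toL2CLE M).symm).continuous.tendsto
      0).comp hlim₀
    rwa [map_zero] at this
  exact hfin

end Invariance

end MediumScattering

end

/-! ### Equality of the essential spectra -/

theorem proposition4p1 {d k : ℕ}
    (A : EuclideanSpace ℝ (Fin d) → Matrix (Fin k) (Fin k) ℂ)
    (hA_meas : ∀ i j, AEMeasurable (fun ξ => A ξ i j) volume)
    (hA_herm : ∀ ξ, (A ξ).IsHermitian)
    (hA_carleman : MediumScattering.StronglyCarleman A)
    (M₀ M : MediumScattering.Medium d k)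
    (hV : Tendsto (fun x => M.mat x - M₀.mat x) (cobounded (EuclideanSpace ℝ (Fin d))) (𝓝 0)) :
    MediumScattering.essentialSpectrum (MediumScattering.mediumOp M A) =
      MediumScattering.essentialSpectrum (MediumScattering.mediumOp M₀ A) := by
  have hV' : Tendsto (fun x => M₀.mat x - M.mat x) (cobounded (EuclideanSpace ℝ (Fin d)))
      (𝓝 0) := by
    simpa using hV.neg
  ext z
  rw [← not_iff_not,
    (MediumScattering.isSelfAdjointOp_mediumOp hA_meas hA_herm).notMem_essentialSpectrum_iff,
    (MediumScattering.isSelfAdjointOp_mediumOp hA_meas hA_herm).notMem_essentialSpectrum_iff]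
  exact ⟨.of_medium hA_carleman hV', .of_medium hA_carleman hV⟩
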